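/- Let $x_1,\dots,x_n\in\mathbb{R}^m_+\setminus\{0\}$, $y_1,\dots,y_n\in\mathbb{R}^s_+\setminus\{0\}$, and let $P$, $Q$ be real matrices with $m$ and $s$ rows. Let $$T=\Big\{(x,y)\in\mathbb{R}^m\times\mathbb{R}^s:\ \exists\,\lambda,\alpha,\beta\ge 0,\ \sum_j\lambda_jx_j-P\alpha\le x,\ \sum_j\lambda_jy_j+Q\beta\ge y\Big\},$$ and let $\partial^s(T)$ be the set of $(x,y)\in T$ such that no $(x',y')\ne(x,y)$ with $x'\le x$, $y'\ge y$ belongs to $T$. Assume $$\{v\in\mathbb{R}^m_+: vP\le 0\}\subseteq\mathbb{R}^m_{++}\cup\{0\},\qquad \emptyset\ne\{u\in\mathbb{R}^s_+: uQ\le 0,\ u\ne0\}\subseteq\mathbb{R}^s_{++}.$$ For $(x,y)\in T$ with all coordinates positive define $$D^-(x,y)=\min\Big\{\sum_{i}\tfrac{d_i}{x_i}: d\ge0,\ (x-d,y)\in\partial^s(T)\Big\},\quad D^+(x,y)=\min\Big\{\sum_{r}\tfrac{e_r}{y_r}: e\ge0,\ (x,y+e)\in\partial^s(T)\Big\},$$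 $$F_S(x,y)=\max\Big(1-\tfrac1m\sum_i\tfrac{d_i}{x_i}\Big)\frac{s}{\sum_r(1+e_r/y_r)},\qquad F_B(x,y)=\max\Big(1-\tfrac1m\sum_i\tfrac{d_i}{x_i}\Big)\frac1s\sum_r\frac1{1+e_r/y_r},$$ the maxima being over $d,e\ge0$ with $(x-d,y+e)\in\partial^s(T)$. For $z\ge0$ put $I(z)=\{l: z_l>0\}$. For $(x,y)\in T$ with $x\ge0$, $x\neq0$, $y\ge0$, $y\ne0$, let $\delta\ge0$ and $\eta\ge0$ range over the vectors with $\delta_i=0$ for $i\notin I(x)$ and $\eta_r=0$ for $r\notin I(y)$, let $x_\delta=x-\sum_{i\in I(x)}\delta_ix_ie_i$, $y_\eta=y+\sum_{r\in I(y)}\eta_ry_re_r$, and define $$D^{\natural-}(x,y)=\min\Big\{\sum_{i\in I(x)}\delta_i:(x_\delta,y)\in\partial^s(T)\Big\},\quad D^{\natural+}(x,y)=\min\Big\{\sum_{r\in I(y)}\eta_r:(x,y_\eta)\in\partial^s(T)\Big\},$$ $$F^\natural_S(x,y)=\max\Big(1-\tfrac1m\sum_{i\in I(x)}\delta_i\Big)\frac{s}{s+\sum_{r\in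 I(y)}\eta_r},$$ $$F^\natural_B(x,y)=\max\Big(1-\tfrac1m\sum_{i\in I(x)}\delta_i\Big)\Big(\frac1s\sum_{r\in I(y)}\frac1{1+\eta_r}+1-\frac{|I(y)|}{s}\Big),$$ the maxima being over $(\delta,\eta)$ with $(x_\delta,y_\eta)\in\partial^s(T)$. A minimum or maximum over the empty set is read as $0$ (this is needed only if $\{v\in\mathbb{R}^m_+: vP\le0\}=\{0\}$). Let $(x,y)\in T$ with $x\ge0$, $x\ne0$, $y\ge0$, $y\ne0$. Let $\mathscr{E}(x,y)$ be the set of $(\epsilon^-,\epsilon^+)\in\mathbb{R}^{m+s}$ with $\epsilon^-_i=0$ for $i\in I(x)$, $\epsilon^-_i>0$ for $i\notin I(x)$, $\epsilon^+_r=0$ for $r\in I(y)$, $\epsilon^+_r>0$ for $r\notin I(y)$. Then, as $(\epsilon^-,\epsilon^+)\to(0,0)$ within the set of those elements of $\mathscr{E}(x,y)$ for which $(x+\epsilon^-,y+\epsilon^+)\in T$ (the points where the positive-data measures are defined), $$D^-(x+\epsilon^-,y+\epsilon^+)\to D^{\natural-}(x,y),\qquad D^+(x+\epsilon^-,y+\epsilon^+)\to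 D^{\natural+}(x,y),$$ $$F_S(x+\epsilon^-,y+\epsilon^+)\to F_S^\natural(x,y),\qquad F_B(x+\epsilon^-,y+\epsilon^+)\to F_B^\natural(x,y).$$ Here $(0,0)$ is in the closure of that set of perturbations whenever $x$ has a zero coordinate, or $y$ has no zero coordinate, or $(x,y)\notin\partial^s(T)$. (In the remaining case, $x>0$, $y$ has a zero coordinate and $(x,y)\in\partial^s(T)$, the set is empty and the limit assertions are void.) Moreover, if some nonzero $v\in\mathbb{R}^m_+$ satisfies $vP\le0$, then all the minima and maxima above, at $(x,y)$ and at the points $(x+\epsilon^-,y+\epsilon^+)$ considered, are attained. -/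

import Mathlib

open Filter Topology Matrix

noncomputable section

namespace DEA

/-- Index set of the positive coordinates of a vector. -/
def posIdx {l : ℕ} (z : Fin l → ℝ) : Finset (Fin l) :=
  Finset.univ.filter (fun i => 0 < z i)

/-- Admissible weights: nonnegative row vectors `w` with `w M ≤ 0`. -/
def weightCone {l k : ℕ} (M : Matrix (Fin l) (Fin k) ℝ) : Set (Fin l → ℝ) :=
  {w | 0 ≤ w ∧ w ᵥ* M ≤ 0}

/-- Vectors all of whose coordinates are positive. -/
def positive (l : ℕ) : Set (Fin l → ℝ) := {w | ∀ i, 0 < w i}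

/-- Assumption on the input weight restrictions. -/
def InputCond {m p : ℕ} (P : Matrix (Fin m) (Fin p) ℝ) : Prop :=
  weightCone P ⊆ positive m ∪ {0}

/-- Assumption on the output weight restrictions. -/
def OutputCond {s q : ℕ} (Q : Matrix (Fin s) (Fin q) ℝ) : Prop :=
  (weightCone Q \ {0}).Nonempty ∧ weightCone Q \ {0} ⊆ positive s

section Measures

variable {n m s p q : ℕ} (X : Fin n → Fin m → ℝ) (Y : Fin n → Fin s → ℝ)
  (P : Matrix (Fin m) (Fin p) ℝ) (Q : Matrix (Fin s) (Fin q) ℝ)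

/-- The production possibility set generated by the units `(X j, Y j)` and the
production trade-offs `P`, `Q`. -/
def pps : Set ((Fin m → ℝ) × (Fin s → ℝ)) :=
  {z | ∃ (lam : Fin n → ℝ) (α : Fin p → ℝ) (β : Fin q → ℝ),
    0 ≤ lam ∧ 0 ≤ α ∧ 0 ≤ β ∧
    (∑ j, lam j • X j) - P *ᵥ α ≤ z.1 ∧
    z.2 ≤ (∑ j, lam j • Y j) + Q *ᵥ β}

/-- The strongly efficient frontier of the production possibility set. -/
def strongFrontier : Set ((Fin m → ℝ) × (Fin s → ℝ)) :=
  {z | z ∈ pps X Y P Q ∧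
    ∀ z' : (Fin m → ℝ) × (Fin s → ℝ),
      z'.1 ≤ z.1 → z.2 ≤ z'.2 → z' ≠ z → z' ∉ pps X Y P Q}

/-! ### Measures for positive data -/

/-- Objective values of the input-oriented least distance problem. -/
def inputValues (x : Fin m → ℝ) (y : Fin s → ℝ) : Set ℝ :=
  {c | ∃ d : Fin m → ℝ, 0 ≤ d ∧ (x - d, y) ∈ strongFrontier X Y P Q ∧
    c = ∑ i, d i / x i}

/-- Objective values of the output-oriented least distance problem. -/
def outputValues (x : Fin m → ℝ) (y : Fin s → ℝ) : Set ℝ :=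
  {c | ∃ d : Fin s → ℝ, 0 ≤ d ∧ (x, y + d) ∈ strongFrontier X Y P Q ∧
    c = ∑ r, d r / y r}

/-- The input factor of both objective functions. -/
def gMinus (x d : Fin m → ℝ) : ℝ := 1 - (1 / (m : ℝ)) * ∑ i, d i / x i

/-- The output factor of the slacks-based measure. -/
def gPlus (y d : Fin s → ℝ) : ℝ := (s : ℝ) / ∑ r, (1 + d r / y r)

/-- The output factor of the BRWZ measure. -/
def hPlus (y d : Fin s → ℝ) : ℝ := (1 / (s : ℝ)) * ∑ r, 1 / (1 + d r / y r)

/-- Objective values of the max SBM problem. -/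
def sbmValues (x : Fin m → ℝ) (y : Fin s → ℝ) : Set ℝ :=
  {c | ∃ (d : Fin m → ℝ) (e : Fin s → ℝ), 0 ≤ d ∧ 0 ≤ e ∧
    (x - d, y + e) ∈ strongFrontier X Y P Q ∧ c = gMinus x d * gPlus y e}

/-- Objective values of the max BRWZ problem. -/
def brwzValues (x : Fin m → ℝ) (y : Fin s → ℝ) : Set ℝ :=
  {c | ∃ (d : Fin m → ℝ) (e : Fin s → ℝ), 0 ≤ d ∧ 0 ≤ e ∧
    (x - d, y + e) ∈ strongFrontier X Y P Q ∧ c = gMinus x d * hPlus y e}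

/-- Input-oriented least distance inefficiency measure `D⁻`. -/
def DMinus (x : Fin m → ℝ) (y : Fin s → ℝ) : ℝ := sInf (inputValues X Y P Q x y)

/-- Output-oriented least distance inefficiency measure `D⁺`. -/
def DPlus (x : Fin m → ℝ) (y : Fin s → ℝ) : ℝ := sInf (outputValues X Y P Q x y)

/-- The max SBM efficiency measure `F_S`. -/
def FS (x : Fin m → ℝ) (y : Fin s → ℝ) : ℝ := sSup (sbmValues X Y P Q x y)

/-- The max BRWZ efficiency measure `F_B`. -/
def FB (x : Fin m → ℝ) (y : Fin s → ℝ) : ℝ := sSup (brwzValues X Y P Q x y)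

/-! ### Measures for data with zeros -/

/-- The input vector `x - ∑_{i ∈ I(x)} δ_i x_i e_i`. -/
def contract (x δ : Fin m → ℝ) : Fin m → ℝ :=
  x - ∑ i ∈ posIdx x, Pi.single i (δ i * x i)

/-- The output vector `y + ∑_{r ∈ I(y)} δ_r y_r e_r`. -/
def expand (y δ : Fin s → ℝ) : Fin s → ℝ :=
  y + ∑ r ∈ posIdx y, Pi.single r (δ r * y r)

/-- Nonnegative relative slacks that vanish off the positive coordinates of `z`. -/
def relSlack {l : ℕ} (z : Fin l → ℝ) : Set (Fin l → ℝ) :=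
  {δ | 0 ≤ δ ∧ ∀ i, i ∉ posIdx z → δ i = 0}

/-- Objective values of the input-oriented problem for data with zeros. -/
def inputValuesNat (x : Fin m → ℝ) (y : Fin s → ℝ) : Set ℝ :=
  {c | ∃ δ ∈ relSlack x, (contract x δ, y) ∈ strongFrontier X Y P Q ∧
    c = ∑ i ∈ posIdx x, δ i}

/-- Objective values of the output-oriented problem for data with zeros. -/
def outputValuesNat (x : Fin m → ℝ) (y : Fin s → ℝ) : Set ℝ :=
  {c | ∃ δ ∈ relSlack y, (x, expand y δ) ∈ strongFrontier X Y P Q ∧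
    c = ∑ r ∈ posIdx y, δ r}

/-- The input factor for data with zeros. -/
def gMinusNat (x δ : Fin m → ℝ) : ℝ := 1 - (1 / (m : ℝ)) * ∑ i ∈ posIdx x, δ i

/-- The output factor of the slacks-based measure for data with zeros. -/
def gPlusNat (y δ : Fin s → ℝ) : ℝ := (s : ℝ) / ((s : ℝ) + ∑ r ∈ posIdx y, δ r)

/-- The output factor of the BRWZ measure for data with zeros. -/
def hPlusNat (y δ : Fin s → ℝ) : ℝ :=
  (1 / (s : ℝ)) * ∑ r ∈ posIdx y, 1 / (1 + δ r) + 1 - (1 / (s : ℝ)) * ((posIdx y).card : ℝ)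

/-- Objective values of the max SBM problem for data with zeros. -/
def sbmValuesNat (x : Fin m → ℝ) (y : Fin s → ℝ) : Set ℝ :=
  {c | ∃ δ ∈ relSlack x, ∃ η ∈ relSlack y,
    (contract x δ, expand y η) ∈ strongFrontier X Y P Q ∧
    c = gMinusNat x δ * gPlusNat y η}

/-- Objective values of the max BRWZ problem for data with zeros. -/
def brwzValuesNat (x : Fin m → ℝ) (y : Fin s → ℝ) : Set ℝ :=
  {c | ∃ δ ∈ relSlack x, ∃ η ∈ relSlack y,
    (contract x δ, expand y η) ∈ strongFrontier X Y P Q ∧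
    c = gMinusNat x δ * hPlusNat y η}

/-- The measure `D♮⁻`. -/
def DMinusNat (x : Fin m → ℝ) (y : Fin s → ℝ) : ℝ := sInf (inputValuesNat X Y P Q x y)

/-- The measure `D♮⁺`. -/
def DPlusNat (x : Fin m → ℝ) (y : Fin s → ℝ) : ℝ := sInf (outputValuesNat X Y P Q x y)

/-- The measure `F_S♮`. -/
def FSNat (x : Fin m → ℝ) (y : Fin s → ℝ) : ℝ := sSup (sbmValuesNat X Y P Q x y)

/-- The measure `F_B♮`. -/
def FBNat (x : Fin m → ℝ) (y : Fin s → ℝ) : ℝ := sSup (brwzValuesNat X Y P Q x y)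

/-- Perturbations that are positive exactly on the zero coordinates of `(x, y)`
and zero on the positive ones. -/
def perturb (x : Fin m → ℝ) (y : Fin s → ℝ) : Set ((Fin m → ℝ) × (Fin s → ℝ)) :=
  {ε | (∀ i ∈ posIdx x, ε.1 i = 0) ∧ (∀ i, i ∉ posIdx x → 0 < ε.1 i) ∧
    (∀ r ∈ posIdx y, ε.2 r = 0) ∧ (∀ r, r ∉ posIdx y → 0 < ε.2 r)}

/-- Perturbations in `perturb x y` for which the perturbed point stays in the production
possibility set, the domain of the measures for positive data. -/
def admissible (x : Fin m → ℝ) (y : Fin s → ℝ) : Set ((Fin m → ℝ) × (Fin s → ℝ)) :=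
  {ε | ε ∈ perturb x y ∧ (x + ε.1, y + ε.2) ∈ pps X Y P Q}

end Measures

end DEA

end

/-!
If the zero input weight is the only admissible one, then no multiplier is nonzero, Farkas' lemma
(`exists_nonneg_combination_of_forall_nonneg`, in the form `mem_pps_iff`) makes every activity
feasible, the frontier is empty, and all measures vanish by convention.

Otherwise let `gap z` be the minimum of `v · x - u · y` over the compact set of multipliers
`(v, u)` with coordinate sum one. It is continuous, the production possibility set is
`{gap ≥ 0}`, and on activities with a nonnegative nonzero output the strongly efficient frontier
is `{gap = 0}` (`mem_strongFrontier_iff`), because the conditions on the weights make every strict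
improvement of an activity without gap infeasible (`gap_neg_of_gap_nonpos`).

The measure `D⁻` is then the smallest `c` for which contracting a single positive input `i` from
`x i` to `x i - c * x i` exhausts the gap, and similarly for `D⁺`: a multiplier that certifies
that some slack vector leads to the frontier bounds its total relative length from below
(`one_le_sum_div_add_sum_div`). This description is the same for positive data and for data with
zeros. The conditions `c < D` and `D < c` are open in the data: a zero coordinate imposes nothing
on `c`, and nearby it becomes a move of size `c * ε`, which leaves a positive gap positive
(`AxisFamily.continuousOn_dist`).

Frontier slacks of total relative lengths `a` and `b` satisfy `a / D⁻ + b / D⁺ ≥ 1`. Both scores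
are bounded by functions of `(a, b)` that on the line of equality are largest at an end point
(`sbm_score_le`, `brwz_score_le`), so `F_S = max (1 - D⁻ / m) (s / (s + D⁺))` and
`F_B = max (1 - D⁻ / m) (1 - D⁺ / (1 + D⁺) / s)`. All four measures for data with zeros are
therefore continuous and attained on the activities with nonnegative nonzero inputs and outputs,
and the measures for positive data are their restrictions (`inputValues_eq` and its analogues).
-/

noncomputable section

namespace DEA

/-! ### Farkas' lemma and the multiplier description of the production possibility set -/

/-- **Farkas' lemma** for finitely many linear functionals on an arbitrary real vector space.
The induction eliminates one functional `a k` at a time by projecting along a vector `x₀` with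
`a k x₀ = -1` onto the kernel of `a k`; no closedness of finitely generated cones is needed. -/
theorem exists_nonneg_combination_of_forall_nonneg {V ι : Type*} [AddCommGroup V] [Module ℝ V]
    (S : Finset ι) (a : ι → V →ₗ[ℝ] ℝ) (b : V →ₗ[ℝ] ℝ)
    (h : ∀ x, (∀ i ∈ S, 0 ≤ a i x) → 0 ≤ b x) :
    ∃ c : ι → ℝ, (∀ i, 0 ≤ c i) ∧ ∀ x, b x = ∑ i ∈ S, c i * a i x := by
  classical
  induction S using Finset.induction_on generalizing a b with
  | empty =>
    refine ⟨0, fun _ => le_rfl, fun x => ?_⟩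
    have h1 := h x (by simp)
    have h2 := h (-x) (by simp)
    rw [map_neg] at h2
    simp only [Finset.sum_empty]
    linarith
  | insert k S hk ih =>
    by_cases hS : ∀ x, (∀ i ∈ S, 0 ≤ a i x) → 0 ≤ b x
    · obtain ⟨c, hc, hb⟩ := ih a b hS
      refine ⟨Function.update c k 0, fun i => ?_, fun x => ?_⟩
      · by_cases hi : i = k
        · subst hi; simp
        · simp [hi, hc i]
      · rw [hb x, Finset.sum_insert hk, Function.update_self, zero_mul, zero_add]
        refine Finset.sum_congr rfl fun i hi => ?_
        rw [Function.update_of_ne (by rintro rfl; exact hk hi)]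
    · push Not at hS
      obtain ⟨x₁, hx₁, hbx₁⟩ := hS
      have hak : a k x₁ < 0 := by
        by_contra! hcon
        refine absurd (h x₁ fun i hi => ?_) (not_le.2 hbx₁)
        rcases Finset.mem_insert.1 hi with rfl | hi
        exacts [hcon, hx₁ i hi]
      set x₀ : V := (-(a k x₁))⁻¹ • x₁ with hx₀
      have hpos : 0 < (-(a k x₁))⁻¹ := by rw [inv_pos]; linarith
      have hk₀ : a k x₀ = -1 := by
        rw [hx₀, map_smul, smul_eq_mul, inv_mul_eq_div, div_eq_iff (by linarith)]; ring
      have hi₀ : ∀ i ∈ S, 0 ≤ a i x₀ := fun i hi => by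
        rw [hx₀, map_smul]; exact mul_nonneg hpos.le (hx₁ i hi)
      have hb₀ : b x₀ < 0 := by
        rw [hx₀, map_smul]; exact mul_neg_of_pos_of_neg hpos hbx₁
      let T : V →ₗ[ℝ] V := LinearMap.id + (a k).smulRight x₀
      have hT : ∀ x, T x = x + a k x • x₀ := fun x => by simp [T]
      obtain ⟨c, hc, hb⟩ := ih (fun i => (a i).comp T) (b.comp T) fun x hx => by
        refine h (T x) fun i hi => ?_
        rcases Finset.mem_insert.1 hi with rfl | hi
        · rw [hT, map_add, map_smul, hk₀]; simp
        · exact hx i hi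
      have hsum : 0 ≤ ∑ i ∈ S, c i * a i x₀ :=
        Finset.sum_nonneg fun i hi => mul_nonneg (hc i) (hi₀ i hi)
      refine ⟨Function.update c k (∑ i ∈ S, c i * a i x₀ - b x₀), fun i => ?_, fun x => ?_⟩
      · by_cases hi : i = k
        · subst hi; simp; linarith
        · simp [hi, hc i]
      · have h1 := hb x
        simp only [LinearMap.comp_apply, hT, map_add, map_smul, smul_eq_mul, mul_add,
          Finset.sum_add_distrib] at h1
        rw [Finset.sum_insert hk, Function.update_self]
        have h2 : ∑ i ∈ S, Function.update c k (∑ i ∈ S, c i * a i x₀ - b x₀) i * a i x =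
            ∑ i ∈ S, c i * a i x := Finset.sum_congr rfl fun i hi => by
          rw [Function.update_of_ne (by rintro rfl; exact hk hi)]
        have h3 : ∑ i ∈ S, c i * (a k x * a i x₀) = a k x * ∑ i ∈ S, c i * a i x₀ := by
          rw [Finset.mul_sum]; exact Finset.sum_congr rfl fun i _ => by ring
        rw [h2]
        rw [h3] at h1
        linarith

section Multipliers

variable {n m s p q : ℕ}

/-- The value `v · x - u · y` of the activity `z = (x, y)` at the weights `w = (v, u)`. -/
def netValue (w z : (Fin m → ℝ) × (Fin s → ℝ)) : ℝ := w.1 ⬝ᵥ z.1 - w.2 ⬝ᵥ z.2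

/-- The cone of multipliers: pairs `(v, u)` of admissible weights at which no observed unit has a
negative net value. It is the dual cone of the production possibility set. -/
def multiplierCone (X : Fin n → Fin m → ℝ) (Y : Fin n → Fin s → ℝ)
    (P : Matrix (Fin m) (Fin p) ℝ) (Q : Matrix (Fin s) (Fin q) ℝ) :
    Set ((Fin m → ℝ) × (Fin s → ℝ)) :=
  {w | w.1 ∈ weightCone P ∧ w.2 ∈ weightCone Q ∧ ∀ j, 0 ≤ netValue w (X j, Y j)}

variable {X : Fin n → Fin m → ℝ} {Y : Fin n → Fin s → ℝ}
  {P : Matrix (Fin m) (Fin p) ℝ} {Q : Matrix (Fin s) (Fin q) ℝ}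

theorem netValue_nonneg_of_mem_pps {w z : (Fin m → ℝ) × (Fin s → ℝ)}
    (hw : w ∈ multiplierCone X Y P Q) (hz : z ∈ pps X Y P Q) : 0 ≤ netValue w z := by
  obtain ⟨⟨hv, hvP⟩, ⟨hu, huQ⟩, hXY⟩ := hw
  obtain ⟨lam, α, β, hl, hα, hβ, h1, h2⟩ := hz
  have e1 : w.1 ⬝ᵥ ((∑ j, lam j • X j) - P *ᵥ α) ≤ w.1 ⬝ᵥ z.1 :=
    dotProduct_le_dotProduct_of_nonneg_left h1 hv
  have e2 : w.2 ⬝ᵥ z.2 ≤ w.2 ⬝ᵥ ((∑ j, lam j • Y j) + Q *ᵥ β) :=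
    dotProduct_le_dotProduct_of_nonneg_left h2 hu
  have e3 : (w.1 ᵥ* P) ⬝ᵥ α ≤ 0 ⬝ᵥ α := dotProduct_le_dotProduct_of_nonneg_right hvP hα
  have e4 : (w.2 ᵥ* Q) ⬝ᵥ β ≤ 0 ⬝ᵥ β := dotProduct_le_dotProduct_of_nonneg_right huQ hβ
  rw [dotProduct_sub, dotProduct_sum, dotProduct_mulVec] at e1
  rw [dotProduct_add, dotProduct_sum, dotProduct_mulVec] at e2
  rw [zero_dotProduct] at e3 e4
  have e5 : 0 ≤ ∑ j, lam j * netValue w (X j, Y j) :=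
    Finset.sum_nonneg fun j _ => mul_nonneg (hl j) (hXY j)
  simp only [netValue, mul_sub, Finset.sum_sub_distrib] at e5
  simp only [dotProduct_smul, smul_eq_mul] at e1 e2
  unfold netValue
  linarith

theorem mem_pps_iff {z : (Fin m → ℝ) × (Fin s → ℝ)} :
    z ∈ pps X Y P Q ↔ ∀ w ∈ multiplierCone X Y P Q, 0 ≤ netValue w z := by
  refine ⟨fun hz w hw => netValue_nonneg_of_mem_pps hw hz, fun h => ?_⟩
  -- The weights `(v, u)` are the variables; each generator of the set gives one functional.
  let val : (Fin m → ℝ) × (Fin s → ℝ) → ((Fin m → ℝ) × (Fin s → ℝ) →ₗ[ℝ] ℝ) := fun z =>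
    { toFun := fun w => netValue w z
      map_add' := fun w w' => by simp [netValue]; ring
      map_smul' := fun c w => by simp [netValue]; ring }
  have hval : ∀ z w, val z w = netValue w z := fun _ _ => rfl
  let gen : Fin n ⊕ Fin p ⊕ Fin q ⊕ Fin m ⊕ Fin s → (Fin m → ℝ) × (Fin s → ℝ) :=
    Sum.elim (fun j => (X j, Y j)) <| Sum.elim (fun k => (-P.col k, 0)) <|
      Sum.elim (fun k => (0, Q.col k)) <|
        Sum.elim (fun i => (Pi.single i 1, 0)) (fun r => (0, -Pi.single r 1))
  obtain ⟨c, hc, hb⟩ := exists_nonneg_combination_of_forall_nonneg Finset.univ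
    (fun i => val (gen i)) (val z) fun w hw => by
      refine h w ⟨⟨fun i => ?_, fun k => ?_⟩, ⟨fun r => ?_, fun k => ?_⟩, fun j => ?_⟩
      · simpa [gen, hval, netValue] using hw (.inr (.inr (.inr (.inl i)))) (Finset.mem_univ _)
      · change w.1 ⬝ᵥ P.col k ≤ 0
        simpa [gen, hval, netValue] using hw (.inr (.inl k)) (Finset.mem_univ _)
      · simpa [gen, hval, netValue] using hw (.inr (.inr (.inr (.inr r)))) (Finset.mem_univ _)
      · change w.2 ⬝ᵥ Q.col k ≤ 0
        simpa [gen, hval, netValue] using hw (.inr (.inr (.inl k))) (Finset.mem_univ _)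
      · simpa [gen, hval, netValue] using hw (.inl j) (Finset.mem_univ _)
  refine ⟨fun j => c (.inl j), fun k => c (.inr (.inl k)), fun k => c (.inr (.inr (.inl k))),
    fun _ => hc _, fun _ => hc _, fun _ => hc _, fun i => ?_, fun r => ?_⟩
  · have h1 := hb (Pi.single i 1, 0)
    simp only [hval, netValue, gen, Fintype.sum_sum_type, Sum.elim_inl, Sum.elim_inr,
      single_one_dotProduct, zero_dotProduct, sub_zero, Pi.neg_apply, Matrix.col_apply,
      Pi.zero_apply, mul_zero, Finset.sum_const_zero, add_zero, zero_add, mul_neg,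
      Finset.sum_neg_distrib] at h1
    have h2 : 0 ≤ ∑ k, c (.inr (.inr (.inr (.inl k)))) * (Pi.single k (1 : ℝ) : Fin m → ℝ) i :=
      Finset.sum_nonneg fun k _ => mul_nonneg (hc _) (by
        rw [Pi.single_apply]; split_ifs <;> norm_num)
    have h3 : (P *ᵥ fun k => c (.inr (.inl k))) i = ∑ k, c (.inr (.inl k)) * P i k := by
      simp [mulVec, dotProduct, mul_comm]
    simp only [Pi.sub_apply, Finset.sum_apply, Pi.smul_apply, smul_eq_mul, h3]
    linarith
  · have h1 := hb (0, Pi.single r 1)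
    simp only [hval, netValue, gen, Fintype.sum_sum_type, Sum.elim_inl, Sum.elim_inr,
      single_one_dotProduct, zero_dotProduct, zero_sub, Pi.neg_apply, Matrix.col_apply,
      Pi.zero_apply, mul_zero, Finset.sum_const_zero, zero_add, mul_neg,
      Finset.sum_neg_distrib] at h1
    have h2 : 0 ≤ ∑ k, c (.inr (.inr (.inr (.inr k)))) * (Pi.single k (1 : ℝ) : Fin s → ℝ) r :=
      Finset.sum_nonneg fun k _ => mul_nonneg (hc _) (by
        rw [Pi.single_apply]; split_ifs <;> norm_num)
    have h3 : (Q *ᵥ fun k => c (.inr (.inr (.inl k)))) r =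
        ∑ k, c (.inr (.inr (.inl k))) * Q r k := by
      simp [mulVec, dotProduct, mul_comm]
    simp only [Pi.add_apply, Finset.sum_apply, Pi.smul_apply, smul_eq_mul, h3]
    linarith

end Multipliers

/-! ### The efficiency gap -/

theorem dotProduct_pos_of_pos {l : ℕ} {v z : Fin l → ℝ} (hv : v ∈ positive l) (hz : 0 ≤ z)
    (hz0 : z ≠ 0) : 0 < v ⬝ᵥ z := by
  obtain ⟨i, hi⟩ := Function.ne_iff.1 hz0
  exact Finset.sum_pos' (fun k _ => mul_nonneg (hv k).le (hz k))
    ⟨i, Finset.mem_univ _, mul_pos (hv i) (lt_of_le_of_ne (hz i) (Ne.symm hi))⟩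

section Gap

variable {n m s p q : ℕ} (X : Fin n → Fin m → ℝ) (Y : Fin n → Fin s → ℝ)
  (P : Matrix (Fin m) (Fin p) ℝ) (Q : Matrix (Fin s) (Fin q) ℝ)

/-- Multipliers whose coordinates sum to one, a compact base of the multiplier cone. -/
def normalizedMultipliers : Set ((Fin m → ℝ) × (Fin s → ℝ)) :=
  {w | w ∈ multiplierCone X Y P Q ∧ ∑ i, w.1 i + ∑ r, w.2 r = 1}

/-- The smallest net value of an activity over the normalized multipliers. If there are
normalized multipliers, then `gap z ≥ 0` characterizes membership of `z` in the production
possibility set. -/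
def gap (z : (Fin m → ℝ) × (Fin s → ℝ)) : ℝ :=
  sInf ((fun w => netValue w z) '' normalizedMultipliers X Y P Q)

variable {X Y P Q}

theorem continuous_netValue :
    Continuous fun a : ((Fin m → ℝ) × (Fin s → ℝ)) × ((Fin m → ℝ) × (Fin s → ℝ)) =>
      netValue a.1 a.2 := by
  unfold netValue dotProduct; fun_prop

theorem isClosed_weightCone {l k : ℕ} (M : Matrix (Fin l) (Fin k) ℝ) :
    IsClosed (weightCone M) := by
  have h1 : IsClosed {w : Fin l → ℝ | 0 ≤ w} := isClosed_le continuous_const continuous_id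
  have h2 : IsClosed {w : Fin l → ℝ | w ᵥ* M ≤ 0} :=
    isClosed_le (Continuous.matrix_vecMul continuous_id continuous_const) continuous_const
  exact h1.inter h2

theorem isCompact_normalizedMultipliers : IsCompact (normalizedMultipliers X Y P Q) := by
  have hcl : IsClosed (normalizedMultipliers X Y P Q) := by
    have h1 : IsClosed {w : (Fin m → ℝ) × (Fin s → ℝ) | w.1 ∈ weightCone P} :=
      (isClosed_weightCone P).preimage continuous_fst
    have h2 : IsClosed {w : (Fin m → ℝ) × (Fin s → ℝ) | w.2 ∈ weightCone Q} :=
      (isClosed_weightCone Q).preimage continuous_snd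
    have h3 : IsClosed {w : (Fin m → ℝ) × (Fin s → ℝ) | ∀ j, 0 ≤ netValue w (X j, Y j)} := by
      simp only [Set.ofPred_forall]
      exact isClosed_iInter fun j => isClosed_le continuous_const
        (continuous_netValue.comp (continuous_id.prodMk continuous_const))
    have h4 : IsClosed {w : (Fin m → ℝ) × (Fin s → ℝ) | ∑ i, w.1 i + ∑ r, w.2 r = 1} :=
      isClosed_eq (by fun_prop) continuous_const
    exact (h1.inter (h2.inter h3)).inter h4
  refine (isCompact_Icc (a := (0 : (Fin m → ℝ) × (Fin s → ℝ)))
    (b := (fun _ => 1, fun _ => 1))).of_isClosed_subset hcl ?_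
  rintro w ⟨⟨⟨hv, -⟩, ⟨hu, -⟩, -⟩, hsum⟩
  have sv : 0 ≤ ∑ i, w.1 i := Finset.sum_nonneg fun i _ => hv i
  have su : 0 ≤ ∑ r, w.2 r := Finset.sum_nonneg fun r _ => hu r
  refine ⟨⟨hv, hu⟩, fun i => ?_, fun r => ?_⟩
  · have := Finset.single_le_sum (fun i _ => hv i) (Finset.mem_univ i)
    simp only at this ⊢
    linarith
  · have := Finset.single_le_sum (fun i _ => hu i) (Finset.mem_univ r)
    simp only at this ⊢
    linarith

theorem continuous_gap : Continuous (gap X Y P Q) :=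
  isCompact_normalizedMultipliers.continuous_sInf (f := fun z w => netValue w z)
    (continuous_netValue.comp continuous_swap)

theorem exists_gap_eq (hne : (normalizedMultipliers X Y P Q).Nonempty)
    (z : (Fin m → ℝ) × (Fin s → ℝ)) :
    ∃ w ∈ normalizedMultipliers X Y P Q, gap X Y P Q z = netValue w z :=
  isCompact_normalizedMultipliers.exists_sInf_image_eq hne
    (continuous_netValue.comp (continuous_id.prodMk continuous_const)).continuousOn

theorem gap_le {w : (Fin m → ℝ) × (Fin s → ℝ)} (hw : w ∈ normalizedMultipliers X Y P Q)
    (z : (Fin m → ℝ) × (Fin s → ℝ)) : gap X Y P Q z ≤ netValue w z :=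
  csInf_le (isCompact_normalizedMultipliers.image
    (continuous_netValue.comp (continuous_id.prodMk continuous_const))).bddBelow
      (Set.mem_image_of_mem _ hw)

theorem netValue_smul (c : ℝ) (w z : (Fin m → ℝ) × (Fin s → ℝ)) :
    netValue (c • w) z = c * netValue w z := by
  simp [netValue, mul_sub]

theorem weightCone_smul {l k : ℕ} {M : Matrix (Fin l) (Fin k) ℝ} {v : Fin l → ℝ} {c : ℝ}
    (hc : 0 ≤ c) (hv : v ∈ weightCone M) : c • v ∈ weightCone M :=
  ⟨smul_nonneg hc hv.1, by rw [smul_vecMul]; exact smul_nonpos_of_nonneg_of_nonpos hc hv.2⟩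

theorem multiplierCone_smul {w : (Fin m → ℝ) × (Fin s → ℝ)} {c : ℝ} (hc : 0 ≤ c)
    (hw : w ∈ multiplierCone X Y P Q) : c • w ∈ multiplierCone X Y P Q :=
  ⟨weightCone_smul hc hw.1, weightCone_smul hc hw.2.1, fun j => by
    rw [netValue_smul]; exact mul_nonneg hc (hw.2.2 j)⟩

/-- Every nonzero multiplier has a normalization. -/
theorem exists_smul_mem_normalizedMultipliers {w : (Fin m → ℝ) × (Fin s → ℝ)}
    (hw : w ∈ multiplierCone X Y P Q) (hw0 : w ≠ 0) :
    ∃ c : ℝ, 0 < c ∧ c • w ∈ normalizedMultipliers X Y P Q := by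
  have hv := hw.1.1
  have hu := hw.2.1.1
  have sv : 0 ≤ ∑ i, w.1 i := Finset.sum_nonneg fun i _ => hv i
  have su : 0 ≤ ∑ r, w.2 r := Finset.sum_nonneg fun r _ => hu r
  have hpos : 0 < ∑ i, w.1 i + ∑ r, w.2 r := by
    refine lt_of_le_of_ne (by linarith) fun h0 => hw0 ?_
    have e1 := (Fintype.sum_eq_zero_iff_of_nonneg hv).1 (by linarith)
    have e2 := (Fintype.sum_eq_zero_iff_of_nonneg hu).1 (by linarith)
    exact Prod.ext e1 e2
  refine ⟨(∑ i, w.1 i + ∑ r, w.2 r)⁻¹, inv_pos.2 hpos,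
    multiplierCone_smul (inv_pos.2 hpos).le hw, ?_⟩
  simp only [Prod.smul_fst, Prod.smul_snd, Pi.smul_apply, smul_eq_mul, ← Finset.mul_sum]
  rw [← mul_add, inv_mul_cancel₀ hpos.ne']

theorem gap_neg {w z : (Fin m → ℝ) × (Fin s → ℝ)} (hw : w ∈ multiplierCone X Y P Q)
    (hz : netValue w z < 0) : gap X Y P Q z < 0 := by
  have hw0 : w ≠ 0 := by rintro rfl; simp [netValue] at hz
  obtain ⟨c, hc, hcw⟩ := exists_smul_mem_normalizedMultipliers hw hw0
  refine (gap_le hcw z).trans_lt ?_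
  rw [netValue_smul]
  exact mul_neg_of_pos_of_neg hc hz

theorem mem_pps_iff_gap_nonneg (hne : (normalizedMultipliers X Y P Q).Nonempty)
    {z : (Fin m → ℝ) × (Fin s → ℝ)} : z ∈ pps X Y P Q ↔ 0 ≤ gap X Y P Q z := by
  rw [mem_pps_iff]
  constructor
  · intro h
    obtain ⟨w, hw, he⟩ := exists_gap_eq hne z
    exact he ▸ h w hw.1
  · intro h w hw
    by_contra! hcon
    exact absurd (gap_neg hw hcon) (not_lt.2 h)

theorem netValue_anti {w z z' : (Fin m → ℝ) × (Fin s → ℝ)} (hw : w ∈ multiplierCone X Y P Q)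
    (h1 : z'.1 ≤ z.1) (h2 : z.2 ≤ z'.2) : netValue w z' ≤ netValue w z :=
  sub_le_sub (dotProduct_le_dotProduct_of_nonneg_left h1 hw.1.1)
    (dotProduct_le_dotProduct_of_nonneg_left h2 hw.2.1.1)

theorem gap_anti (hne : (normalizedMultipliers X Y P Q).Nonempty)
    {z z' : (Fin m → ℝ) × (Fin s → ℝ)} (h1 : z'.1 ≤ z.1) (h2 : z.2 ≤ z'.2) :
    gap X Y P Q z' ≤ gap X Y P Q z := by
  obtain ⟨w, hw, he⟩ := exists_gap_eq hne z
  rw [he]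
  exact (gap_le hw z').trans (netValue_anti hw.1 h1 h2)

end Gap

section WeightRestrictions

variable {n m s p q : ℕ} {X : Fin n → Fin m → ℝ} {Y : Fin n → Fin s → ℝ}
  {P : Matrix (Fin m) (Fin p) ℝ} {Q : Matrix (Fin s) (Fin q) ℝ}

/-- Without observed units the output weights alone bound all outputs by zero. -/
theorem nonempty_units (hQ : OutputCond Q) {x : Fin m → ℝ} {y : Fin s → ℝ} (hy : 0 ≤ y)
    (hy0 : y ≠ 0) (hT : (x, y) ∈ pps X Y P Q) : Nonempty (Fin n) := by
  by_contra hn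
  rw [not_nonempty_iff] at hn
  obtain ⟨u, hu⟩ := hQ.1
  have h := netValue_nonneg_of_mem_pps (w := (0, u)) ⟨⟨le_rfl, by simp⟩, hu.1, fun j => hn.elim j⟩ hT
  have := dotProduct_pos_of_pos (hQ.2 hu) hy hy0
  simp [netValue] at h
  linarith

theorem eq_zero_of_input_eq_zero [Nonempty (Fin n)] (hY : ∀ j, 0 ≤ Y j ∧ Y j ≠ 0)
    (hQ : OutputCond Q) {w : (Fin m → ℝ) × (Fin s → ℝ)}
    (hw : w ∈ multiplierCone X Y P Q) (hv : w.1 = 0) : w = 0 := by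
  refine Prod.ext hv ?_
  by_contra hu
  obtain ⟨j⟩ := ‹Nonempty (Fin n)›
  have h := hw.2.2 j
  have := dotProduct_pos_of_pos (hQ.2 ⟨hw.2.1, hu⟩) (hY j).1 (hY j).2
  simp [netValue, hv] at h
  linarith

theorem input_pos_of_mem_multiplierCone [Nonempty (Fin n)] (hY : ∀ j, 0 ≤ Y j ∧ Y j ≠ 0)
    (hP : InputCond P) (hQ : OutputCond Q) {w : (Fin m → ℝ) × (Fin s → ℝ)}
    (hw : w ∈ multiplierCone X Y P Q) (hw0 : w ≠ 0) : w.1 ∈ positive m :=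
  (hP hw.1).resolve_right fun hv => hw0 (eq_zero_of_input_eq_zero hY hQ hw hv)

/-- A small multiple of any admissible output weight is compatible with a given admissible input
weight, because all observed inputs have positive value. -/
theorem exists_smul_mem_multiplierCone (hX : ∀ j, 0 ≤ X j ∧ X j ≠ 0)
    {v : Fin m → ℝ} (hv : v ∈ weightCone P)
    (hv' : v ∈ positive m) {u : Fin s → ℝ} (hu : u ∈ weightCone Q) :
    ∃ c : ℝ, 0 < c ∧ (v, c • u) ∈ multiplierCone X Y P Q := by
  have h : ∀ j, ∀ᶠ c : ℝ in 𝓝[>] 0, 0 < netValue (v, c • u) (X j, Y j) := fun j => by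
    have hc : Continuous fun c : ℝ => netValue (v, c • u) (X j, Y j) := by
      unfold netValue dotProduct; fun_prop
    refine (hc.tendsto 0).mono_left nhdsWithin_le_nhds |>.eventually_const_lt ?_
    simpa [netValue] using dotProduct_pos_of_pos hv' (hX j).1 (hX j).2
  obtain ⟨c, hc, hc0⟩ := ((eventually_all.2 h).and self_mem_nhdsWithin).exists
  exact ⟨c, hc0, hv, weightCone_smul (le_of_lt hc0) hu, fun j => (hc j).le⟩

/-- A multiplier both of whose components are positive. -/
theorem exists_positive_multiplier (hX : ∀ j, 0 ≤ X j ∧ X j ≠ 0)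
    (hP : InputCond P) (hQ : OutputCond Q) (hv : ∃ v ∈ weightCone P, v ≠ 0) :
    ∃ w ∈ multiplierCone X Y P Q, w.1 ∈ positive m ∧ w.2 ∈ positive s := by
  obtain ⟨v, hv, hv0⟩ := hv
  obtain ⟨u, hu⟩ := hQ.1
  have hvp := (hP hv).resolve_right hv0
  obtain ⟨c, hc, h⟩ := exists_smul_mem_multiplierCone (Y := Y) hX hv hvp hu.1
  exact ⟨_, h, hvp, fun r => mul_pos hc (hQ.2 hu r)⟩

/-- The gap becomes negative when an activity without gap and with a nonzero output is strictly
improved. The minimizing multiplier may put no weight on outputs; then a small positive output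
weight is added to it. -/
theorem gap_neg_of_gap_nonpos [Nonempty (Fin n)] (hX : ∀ j, 0 ≤ X j ∧ X j ≠ 0)
    (hY : ∀ j, 0 ≤ Y j ∧ Y j ≠ 0) (hP : InputCond P) (hQ : OutputCond Q)
    (hne : (normalizedMultipliers X Y P Q).Nonempty) {z z' : (Fin m → ℝ) × (Fin s → ℝ)}
    (hz : gap X Y P Q z ≤ 0) (hy : 0 ≤ z.2) (hy0 : z.2 ≠ 0) (h1 : z'.1 ≤ z.1) (h2 : z.2 ≤ z'.2)
    (hzz : z' ≠ z) : gap X Y P Q z' < 0 := by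
  obtain ⟨w, hw, he⟩ := exists_gap_eq hne z
  have hw0 : w ≠ 0 := by rintro rfl; simpa using hw.2
  have hv := input_pos_of_mem_multiplierCone hY hP hQ hw.1 hw0
  have hwz : netValue w z ≤ 0 := he ▸ hz
  by_cases hu : w.2 = 0
  · obtain ⟨u, hu'⟩ := hQ.1
    obtain ⟨c, hc, h⟩ := exists_smul_mem_multiplierCone (Y := Y) hX hw.1.1 hv hu'.1
    refine gap_neg h ((netValue_anti h h1 h2).trans_lt ?_)
    have := mul_pos hc (dotProduct_pos_of_pos (hQ.2 hu') hy hy0)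
    simp only [netValue, hu, zero_dotProduct, sub_zero, smul_dotProduct, smul_eq_mul] at hwz ⊢
    linarith
  · have hup : w.2 ∈ positive s := hQ.2 ⟨hw.1.2.1, hu⟩
    refine gap_neg hw.1 (lt_of_lt_of_le ?_ hwz)
    have e1 : 0 ≤ z.1 - z'.1 := sub_nonneg.2 h1
    have e2 : 0 ≤ z'.2 - z.2 := sub_nonneg.2 h2
    have key : 0 < w.1 ⬝ᵥ (z.1 - z'.1) + w.2 ⬝ᵥ (z'.2 - z.2) := by
      by_cases hd : z.1 - z'.1 = 0
      · have he' : z'.2 - z.2 ≠ 0 := fun h0 =>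
          hzz (Prod.ext (sub_eq_zero.1 hd).symm (sub_eq_zero.1 h0))
        rw [hd, dotProduct_zero, zero_add]
        exact dotProduct_pos_of_pos hup e2 he'
      · exact add_pos_of_pos_of_nonneg (dotProduct_pos_of_pos hv e1 hd)
          (dotProduct_nonneg_of_nonneg hw.1.2.1.1 e2)
    rw [dotProduct_sub, dotProduct_sub] at key
    unfold netValue
    linarith

/-- On activities with a nonzero output vector the strongly efficient frontier is the zero set of
the gap. -/
theorem mem_strongFrontier_iff [Nonempty (Fin n)] [Nonempty (Fin m)]
    (hX : ∀ j, 0 ≤ X j ∧ X j ≠ 0)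
    (hY : ∀ j, 0 ≤ Y j ∧ Y j ≠ 0) (hP : InputCond P) (hQ : OutputCond Q)
    (hne : (normalizedMultipliers X Y P Q).Nonempty) {z : (Fin m → ℝ) × (Fin s → ℝ)}
    (hy : 0 ≤ z.2) (hy0 : z.2 ≠ 0) : z ∈ strongFrontier X Y P Q ↔ gap X Y P Q z = 0 := by
  constructor
  · rintro ⟨hz, hmax⟩
    refine le_antisymm ?_ ((mem_pps_iff_gap_nonneg hne).1 hz)
    by_contra! hpos
    obtain ⟨i⟩ := ‹Nonempty (Fin m)›
    have hc : Continuous fun t : ℝ => gap X Y P Q (z.1 - Pi.single i t, z.2) :=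
      continuous_gap.comp (Continuous.prodMk
        (continuous_const.sub (continuous_single (A := fun _ => ℝ) i)) continuous_const)
    have hev : ∀ᶠ t in 𝓝[>] (0 : ℝ), 0 < gap X Y P Q (z.1 - Pi.single i t, z.2) :=
      ((hc.tendsto 0).mono_left nhdsWithin_le_nhds).eventually_const_lt (by simpa using hpos)
    obtain ⟨t, ht, ht0⟩ : ∃ t, 0 < gap X Y P Q (z.1 - Pi.single i t, z.2) ∧ 0 < t :=
      (hev.and self_mem_nhdsWithin).exists
    have hin : (z.1 - Pi.single i t, z.2) ∈ pps X Y P Q :=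
      (mem_pps_iff_gap_nonneg hne).2 (le_of_lt ht)
    have hle : z.1 - Pi.single i t ≤ z.1 :=
      sub_le_self z.1 (Pi.single_nonneg (α := fun _ : Fin m => ℝ).2 ht0.le)
    refine hmax (z.1 - Pi.single i t, z.2) hle (le_refl z.2) (fun h => ?_) hin
    have := congrArg (fun z => z.1 i) h
    simp only [Pi.sub_apply, Pi.single_eq_same] at this
    linarith
  · intro hz
    refine ⟨(mem_pps_iff_gap_nonneg hne).2 hz.ge, fun z' h1 h2 hzz hz' => ?_⟩
    have := gap_neg_of_gap_nonpos hX hY hP hQ hne hz.le hy hy0 h1 h2 hzz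
    exact absurd ((mem_pps_iff_gap_nonneg hne).1 hz') (not_le.2 this)

/-- If only the zero input weight is admissible, then every activity is feasible. -/
theorem pps_eq_univ [Nonempty (Fin n)] (hY : ∀ j, 0 ≤ Y j ∧ Y j ≠ 0)
    (hQ : OutputCond Q) (hv : ¬ ∃ v ∈ weightCone P, v ≠ 0) :
    pps X Y P Q = Set.univ := by
  refine Set.eq_univ_of_forall fun z => mem_pps_iff.2 fun w hw => ?_
  push Not at hv
  simp [eq_zero_of_input_eq_zero hY hQ hw (hv _ hw.1), netValue]

theorem strongFrontier_eq_empty [Nonempty (Fin n)] [Nonempty (Fin m)]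
    (hY : ∀ j, 0 ≤ Y j ∧ Y j ≠ 0) (hQ : OutputCond Q) (hv : ¬ ∃ v ∈ weightCone P, v ≠ 0) :
    strongFrontier X Y P Q = ∅ := by
  refine Set.eq_empty_of_forall_notMem fun z hz => ?_
  refine hz.2 (z.1 - 1, z.2) (sub_le_self _ zero_le_one) le_rfl (fun h => ?_) (by
    rw [pps_eq_univ hY hQ hv]; trivial)
  have := congrArg (fun z => z.1 (Classical.arbitrary _)) h
  simp at this

end WeightRestrictions

/-! ### Distances along coordinate directions -/

/-- A finite family of parametrized moves `c ↦ h k c z` of a gap function `g`, where the moves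
with `act k z` strictly decrease the gap from the moment it vanishes and eventually make it
negative, whereas the other moves do not change it. -/
structure AxisFamily {Z K : Type*} [TopologicalSpace Z] (S : Set Z) (g : Z → ℝ)
    (act : K → Z → Prop) (h : K → ℝ → Z → ℝ) : Prop where
  continuous : ∀ k, Continuous fun a : ℝ × Z => h k a.1 a.2
  zero : ∀ k z, h k 0 z = g z
  inactive : ∀ k, ∀ z ∈ S, ¬ act k z → ∀ c, h k c z = g z
  anti : ∀ k, ∀ z ∈ S, ∀ c c', c ≤ c' → h k c' z ≤ h k c z
  strict : ∀ k, ∀ z ∈ S, act k z → ∀ c c', 0 ≤ c → c < c' → h k c z ≤ 0 → h k c' z < 0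
  neg : ∀ k, ∀ z ∈ S, act k z → ∃ c, h k c z < 0
  exists_act : ∀ z ∈ S, ∃ k, act k z
  gap_nonneg : ∀ z ∈ S, 0 ≤ g z

/-- `D` is the smallest length at which one of the moves of `z` exhausts the gap. -/
def IsAxisDist {Z K : Type*} (act : K → Z → Prop) (h : K → ℝ → Z → ℝ) (z : Z) (D : ℝ) : Prop :=
  0 ≤ D ∧ (∀ k, 0 ≤ h k D z) ∧ ∃ k, act k z ∧ h k D z = 0

namespace AxisFamily

variable {Z K : Type*} [TopologicalSpace Z] {S : Set Z} {g : Z → ℝ} {act : K → Z → Prop}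
  {h : K → ℝ → Z → ℝ}

theorem exists_isAxisDist [Finite K] (H : AxisFamily S g act h) {z : Z} (hz : z ∈ S) :
    ∃ D, IsAxisDist act h z D := by
  set A : Set ℝ := {c | 0 ≤ c ∧ ∀ k, 0 ≤ h k c z} with hA
  have hcont : ∀ k, Continuous fun c => h k c z := fun k =>
    (H.continuous k).comp (continuous_id.prodMk continuous_const)
  have hcl : IsClosed A := by
    have h1 : IsClosed {c : ℝ | ∀ k, 0 ≤ h k c z} := by
      simp only [Set.ofPred_forall]
      exact isClosed_iInter fun k => isClosed_le continuous_const (hcont k)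
    exact isClosed_Ici.inter h1
  have h0 : (0 : ℝ) ∈ A := ⟨le_rfl, fun k => by rw [H.zero]; exact H.gap_nonneg z hz⟩
  obtain ⟨k₀, hk₀⟩ := H.exists_act z hz
  obtain ⟨c₀, hc₀⟩ := H.neg k₀ z hz hk₀
  have hbdd : BddAbove A := ⟨c₀, fun c hc => by
    by_contra! hlt
    exact absurd (hc.2 k₀) (not_le.2 ((H.anti k₀ z hz _ _ hlt.le).trans_lt hc₀))⟩
  obtain ⟨hD0, hD⟩ : sSup A ∈ A := hcl.csSup_mem ⟨0, h0⟩ hbdd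
  refine ⟨sSup A, hD0, hD, ?_⟩
  by_contra! hno
  have hpos : ∀ k, act k z → 0 < h k (sSup A) z := fun k hk =>
    lt_of_le_of_ne (hD k) (Ne.symm (hno k hk))
  have hev : ∀ᶠ c in 𝓝[>] (sSup A), ∀ k, 0 ≤ h k c z := by
    refine eventually_all.2 fun k => ?_
    by_cases hk : act k z
    · exact ((((hcont k).tendsto _).mono_left nhdsWithin_le_nhds).eventually_const_lt
        (hpos k hk)).mono fun c hc => hc.le
    · exact Eventually.of_forall fun c => by
        rw [H.inactive k z hz hk]; exact H.gap_nonneg z hz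
  obtain ⟨c, hc, hcD⟩ := (hev.and self_mem_nhdsWithin).exists
  exact absurd (le_csSup hbdd ⟨hD0.trans (le_of_lt hcD), hc⟩) (not_le.2 hcD)

theorem dist_eq_zero_iff (H : AxisFamily S g act h) {z : Z} (hz : z ∈ S) {D : ℝ}
    (hD : IsAxisDist act h z D) : D = 0 ↔ g z = 0 := by
  obtain ⟨hD0, hD1, k, hk, hkD⟩ := hD
  constructor
  · rintro rfl
    rwa [H.zero] at hkD
  · intro hg
    by_contra hne
    have := H.strict k z hz hk 0 D le_rfl (lt_of_le_of_ne hD0 (Ne.symm hne)) (by rw [H.zero, hg])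
    linarith

/-- Both `c < D z` and `D z < c` are open conditions on `z`. At the base point inactive moves
impose nothing beyond positivity of the gap, so moves that become active nearby do no harm. -/
theorem continuousOn_dist [Finite K] (H : AxisFamily S g act h) {D : Z → ℝ}
    (hD : ∀ z ∈ S, IsAxisDist act h z (D z)) : ContinuousOn D S := by
  have hcont : ∀ k c, Continuous fun z => h k c z := fun k c =>
    (H.continuous k).comp (continuous_const.prodMk continuous_id)
  intro z hz
  obtain ⟨hD0, hD1, k₀, hk₀, hkD⟩ := hD z hz
  refine tendsto_order.2 ⟨fun c hc => ?_, fun c hc => ?_⟩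
  · rcases lt_or_ge c 0 with hneg | hc0
    · exact eventually_mem_nhdsWithin.mono fun z' hz' => hneg.trans_le (hD z' hz').1
    have hact : ∀ k, act k z → 0 < h k c z := fun k hk => by
      by_contra! hle
      exact absurd (hD1 k) (not_le.2 (H.strict k z hz hk c _ hc0 hc hle))
    have hg : 0 < g z := by
      rw [← H.zero k₀]
      exact (hact k₀ hk₀).trans_le (H.anti k₀ z hz _ _ hc0)
    have hpos : ∀ k, 0 < h k c z := fun k => by
      by_cases hk : act k z
      · exact hact k hk
      · rwa [H.inactive k z hz hk]
    have hev : ∀ᶠ z' in 𝓝[S] z, ∀ k, 0 < h k c z' := eventually_all.2 fun k =>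
      (((hcont k c).tendsto z).mono_left nhdsWithin_le_nhds).eventually_const_lt (hpos k)
    filter_upwards [hev, self_mem_nhdsWithin] with z' hz' hS
    obtain ⟨-, -, k, -, hk⟩ := hD z' hS
    by_contra! hle
    have := H.anti k z' hS _ _ hle
    linarith [hz' k]
  · have hneg : h k₀ c z < 0 := H.strict k₀ z hz hk₀ _ c hD0 hc hkD.le
    have hev : ∀ᶠ z' in 𝓝[S] z, h k₀ c z' < 0 :=
      (((hcont k₀ c).tendsto z).mono_left nhdsWithin_le_nhds).eventually_lt_const hneg
    filter_upwards [hev, self_mem_nhdsWithin] with z' hz' hS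
    by_contra! hle
    have := H.anti k₀ z' hS _ _ hle
    linarith [(hD z' hS).2.1 k₀]

end AxisFamily

section Moves

variable {n m s p q : ℕ} (X : Fin n → Fin m → ℝ) (Y : Fin n → Fin s → ℝ)
  (P : Matrix (Fin m) (Fin p) ℝ) (Q : Matrix (Fin s) (Fin q) ℝ)

/-- The activities with nonnegative and nonzero inputs and outputs in the production possibility
set. -/
def dataSet : Set ((Fin m → ℝ) × (Fin s → ℝ)) :=
  {z | 0 ≤ z.1 ∧ z.1 ≠ 0 ∧ 0 ≤ z.2 ∧ z.2 ≠ 0 ∧ z ∈ pps X Y P Q}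

/-- The gap after relative contraction of the inputs by `δ` and relative expansion of the outputs
by `η`. -/
def movedGap (δ : Fin m → ℝ) (η : Fin s → ℝ) (z : (Fin m → ℝ) × (Fin s → ℝ)) : ℝ :=
  gap X Y P Q (z.1 - δ * z.1, z.2 + η * z.2)

/-- The distance at which contraction of a single positive input closes the gap. -/
def IsInputDist (z : (Fin m → ℝ) × (Fin s → ℝ)) (D : ℝ) : Prop :=
  IsAxisDist (fun i z => 0 < z.1 i) (fun i c => movedGap X Y P Q (Pi.single i c) 0) z D

/-- The distance at which expansion of a single positive output closes the gap. -/
def IsOutputDist (z : (Fin m → ℝ) × (Fin s → ℝ)) (D : ℝ) : Prop :=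
  IsAxisDist (fun r z => 0 < z.2 r) (fun r c => movedGap X Y P Q 0 (Pi.single r c)) z D

variable {X Y P Q}

theorem exists_pos_of_nonneg_of_ne_zero {l : ℕ} {z : Fin l → ℝ} (hz : 0 ≤ z) (hz0 : z ≠ 0) :
    ∃ i, 0 < z i := by
  obtain ⟨i, hi⟩ := Function.ne_iff.1 hz0
  exact ⟨i, lt_of_le_of_ne (hz i) (Ne.symm hi)⟩

theorem continuous_movedGap {A : Type*} [TopologicalSpace A] {δ : A → Fin m → ℝ}
    {η : A → Fin s → ℝ} {z : A → (Fin m → ℝ) × (Fin s → ℝ)} (hδ : Continuous δ)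
    (hη : Continuous η) (hz : Continuous z) :
    Continuous fun a => movedGap X Y P Q (δ a) (η a) (z a) := by
  have h : Continuous fun a => ((z a).1 - δ a * (z a).1, (z a).2 + η a * (z a).2) := by fun_prop
  exact continuous_gap.comp h

theorem single_mul_eq_zero {l : ℕ} {z : Fin l → ℝ} {i : Fin l} (hz : z i = 0) (c : ℝ) :
    Pi.single i c * z = 0 := by
  rw [← Pi.single_mul_left, hz, mul_zero, Pi.single_zero]

theorem single_mul_ne {l : ℕ} {z : Fin l → ℝ} {i : Fin l} (hz : 0 < z i) {c c' : ℝ}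
    (hc : c < c') : Pi.single i c * z ≠ Pi.single i c' * z := fun h => by
  have := congrFun h i
  simp only [Pi.mul_apply, Pi.single_eq_same] at this
  exact hc.ne (mul_right_cancel₀ hz.ne' this)

theorem add_mul_nonneg {l : ℕ} {y η : Fin l → ℝ} (hy : 0 ≤ y) (hη : 0 ≤ η) : 0 ≤ y + η * y :=
  add_nonneg hy (mul_nonneg hη hy)

theorem add_mul_ne_zero {l : ℕ} {y η : Fin l → ℝ} (hy : 0 ≤ y) (hy0 : y ≠ 0) (hη : 0 ≤ η) :
    y + η * y ≠ 0 := fun h =>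
  hy0 (le_antisymm (h ▸ le_add_of_nonneg_right (mul_nonneg hη hy)) hy)

theorem normalizedMultipliers_nonempty [Nonempty (Fin m)] (hX : ∀ j, 0 ≤ X j ∧ X j ≠ 0)
    (hP : InputCond P) (hQ : OutputCond Q) (hv : ∃ v ∈ weightCone P, v ≠ 0) :
    (normalizedMultipliers X Y P Q).Nonempty := by
  obtain ⟨w, hw, hw1, -⟩ := exists_positive_multiplier (X := X) (Y := Y) hX hP hQ hv
  have hw0 : w ≠ 0 := by
    rintro rfl
    exact absurd (hw1 (Classical.arbitrary _)) (lt_irrefl _)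
  obtain ⟨c, -, h⟩ := exists_smul_mem_normalizedMultipliers hw hw0
  exact ⟨_, h⟩

theorem movedGap_anti (hne : (normalizedMultipliers X Y P Q).Nonempty)
    {z : (Fin m → ℝ) × (Fin s → ℝ)} (hx : 0 ≤ z.1) (hy : 0 ≤ z.2) {δ δ' : Fin m → ℝ}
    {η η' : Fin s → ℝ} (hδ : δ ≤ δ') (hη : η ≤ η') :
    movedGap X Y P Q δ' η' z ≤ movedGap X Y P Q δ η z :=
  gap_anti (z := (z.1 - δ * z.1, z.2 + η * z.2)) (z' := (z.1 - δ' * z.1, z.2 + η' * z.2)) hne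
    (sub_le_sub_left (mul_le_mul_of_nonneg_right hδ hx) _)
    (add_le_add_right (mul_le_mul_of_nonneg_right hη hy) _)

theorem movedGap_neg_of_movedGap_nonpos [Nonempty (Fin n)] (hX : ∀ j, 0 ≤ X j ∧ X j ≠ 0)
    (hY : ∀ j, 0 ≤ Y j ∧ Y j ≠ 0) (hP : InputCond P) (hQ : OutputCond Q)
    (hne : (normalizedMultipliers X Y P Q).Nonempty) {z : (Fin m → ℝ) × (Fin s → ℝ)}
    (hx : 0 ≤ z.1) (hy : 0 ≤ z.2) (hy0 : z.2 ≠ 0) {δ δ' : Fin m → ℝ} {η η' : Fin s → ℝ}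
    (hη0 : 0 ≤ η) (hδ : δ ≤ δ') (hη : η ≤ η') (hne' : δ * z.1 ≠ δ' * z.1 ∨ η * z.2 ≠ η' * z.2)
    (h : movedGap X Y P Q δ η z ≤ 0) : movedGap X Y P Q δ' η' z < 0 := by
  refine gap_neg_of_gap_nonpos (z := (z.1 - δ * z.1, z.2 + η * z.2))
    (z' := (z.1 - δ' * z.1, z.2 + η' * z.2)) hX hY hP hQ hne h
    (add_mul_nonneg hy hη0) (add_mul_ne_zero hy hy0 hη0)
    (sub_le_sub_left (mul_le_mul_of_nonneg_right hδ hx) _)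
    (add_le_add_right (mul_le_mul_of_nonneg_right hη hy) _) fun he => ?_
  obtain ⟨e1, e2⟩ := Prod.mk.inj he
  rcases hne' with hne' | hne'
  · exact hne' (sub_right_injective e1).symm
  · exact hne' (add_right_injective _ e2).symm

theorem inputAxisFamily [Nonempty (Fin n)] [Nonempty (Fin m)] (hX : ∀ j, 0 ≤ X j ∧ X j ≠ 0)
    (hY : ∀ j, 0 ≤ Y j ∧ Y j ≠ 0) (hP : InputCond P) (hQ : OutputCond Q)
    (hv : ∃ v ∈ weightCone P, v ≠ 0) :
    AxisFamily (dataSet X Y P Q) (gap X Y P Q) (fun i z => 0 < z.1 i)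
      (fun i c => movedGap X Y P Q (Pi.single i c) 0) where
  continuous i := by
    have h : Continuous fun a : ℝ × ((Fin m → ℝ) × (Fin s → ℝ)) => (Pi.single i a.1 : Fin m → ℝ) :=
      (continuous_single (A := fun _ => ℝ) i).comp continuous_fst
    exact continuous_movedGap h continuous_const continuous_snd
  zero i z := by simp [movedGap]
  inactive i z hz hi c := by
    have : z.1 i = 0 := le_antisymm (not_lt.1 hi) (hz.1 i)
    simp [movedGap, single_mul_eq_zero this]
  anti i z hz c c' hc := movedGap_anti (normalizedMultipliers_nonempty hX hP hQ hv) hz.1 hz.2.2.1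
    (Pi.single_le_single.2 hc) (le_refl 0)
  strict i z hz hi c c' hc hcc h :=
    movedGap_neg_of_movedGap_nonpos hX hY hP hQ (normalizedMultipliers_nonempty hX hP hQ hv) hz.1
      hz.2.2.1 hz.2.2.2.1 (le_refl 0) (Pi.single_le_single.2 hcc.le) (le_refl 0)
      (.inl (single_mul_ne hi hcc)) h
  neg i z hz hi := by
    obtain ⟨w, hw, hw1, -⟩ := exists_positive_multiplier (X := X) (Y := Y) hX hP hQ hv
    have hpos : 0 < w.1 i * z.1 i := mul_pos (hw1 i) hi
    refine ⟨(netValue w z + 1) / (w.1 i * z.1 i), gap_neg hw ?_⟩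
    rw [← Pi.single_mul_left]
    simp only [netValue, dotProduct_sub, dotProduct_single, zero_mul, add_zero]
    have : w.1 i * ((w.1 ⬝ᵥ z.1 - w.2 ⬝ᵥ z.2 + 1) / (w.1 i * z.1 i) * z.1 i) =
        w.1 ⬝ᵥ z.1 - w.2 ⬝ᵥ z.2 + 1 := by
      have h1 := (hw1 i).ne'
      have h2 := hi.ne'
      field_simp
    linarith
  exists_act z hz := exists_pos_of_nonneg_of_ne_zero hz.1 hz.2.1
  gap_nonneg z hz :=
    (mem_pps_iff_gap_nonneg (normalizedMultipliers_nonempty hX hP hQ hv)).1 hz.2.2.2.2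

theorem outputAxisFamily [Nonempty (Fin n)] [Nonempty (Fin m)] (hX : ∀ j, 0 ≤ X j ∧ X j ≠ 0)
    (hY : ∀ j, 0 ≤ Y j ∧ Y j ≠ 0) (hP : InputCond P) (hQ : OutputCond Q)
    (hv : ∃ v ∈ weightCone P, v ≠ 0) :
    AxisFamily (dataSet X Y P Q) (gap X Y P Q) (fun r z => 0 < z.2 r)
      (fun r c => movedGap X Y P Q 0 (Pi.single r c)) where
  continuous r := by
    have h : Continuous fun a : ℝ × ((Fin m → ℝ) × (Fin s → ℝ)) => (Pi.single r a.1 : Fin s → ℝ) :=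
      (continuous_single (A := fun _ => ℝ) r).comp continuous_fst
    exact continuous_movedGap continuous_const h continuous_snd
  zero r z := by simp [movedGap]
  inactive r z hz hr c := by
    have : z.2 r = 0 := le_antisymm (not_lt.1 hr) (hz.2.2.1 r)
    simp [movedGap, single_mul_eq_zero this]
  anti r z hz c c' hc := movedGap_anti (normalizedMultipliers_nonempty hX hP hQ hv) hz.1 hz.2.2.1
    (le_refl 0) (Pi.single_le_single.2 hc)
  strict r z hz hr c c' hc hcc h :=
    movedGap_neg_of_movedGap_nonpos hX hY hP hQ (normalizedMultipliers_nonempty hX hP hQ hv) hz.1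
      hz.2.2.1 hz.2.2.2.1 (Pi.single_nonneg.2 hc) (le_refl 0) (Pi.single_le_single.2 hcc.le)
      (.inr (single_mul_ne hr hcc)) h
  neg r z hz hr := by
    obtain ⟨w, hw, -, hw2⟩ := exists_positive_multiplier (X := X) (Y := Y) hX hP hQ hv
    have hpos : 0 < w.2 r * z.2 r := mul_pos (hw2 r) hr
    refine ⟨(netValue w z + 1) / (w.2 r * z.2 r), gap_neg hw ?_⟩
    rw [← Pi.single_mul_left]
    simp only [netValue, dotProduct_add, dotProduct_single, zero_mul, sub_zero]
    have : w.2 r * ((w.1 ⬝ᵥ z.1 - w.2 ⬝ᵥ z.2 + 1) / (w.2 r * z.2 r) * z.2 r) =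
        w.1 ⬝ᵥ z.1 - w.2 ⬝ᵥ z.2 + 1 := by
      have h1 := (hw2 r).ne'
      have h2 := hr.ne'
      field_simp
    linarith
  exists_act z hz := exists_pos_of_nonneg_of_ne_zero hz.2.2.1 hz.2.2.2.1
  gap_nonneg z hz :=
    (mem_pps_iff_gap_nonneg (normalizedMultipliers_nonempty hX hP hQ hv)).1 hz.2.2.2.2

/-- Slacks leading out of the interior have total relative length at least one when lengths are
measured in units of the coordinate distances. A single multiplier with nonpositive value at the
moved activity witnesses this. -/
theorem one_le_sum_div_add_sum_div (hne : (normalizedMultipliers X Y P Q).Nonempty)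
    {z : (Fin m → ℝ) × (Fin s → ℝ)} (hg : 0 < gap X Y P Q z) {A B : ℝ} (hA : 0 < A) (hB : 0 < B)
    (hA' : ∀ i, 0 ≤ movedGap X Y P Q (Pi.single i A) 0 z)
    (hB' : ∀ r, 0 ≤ movedGap X Y P Q 0 (Pi.single r B) z)
    {δ : Fin m → ℝ} {η : Fin s → ℝ} (hδ : 0 ≤ δ) (hη : 0 ≤ η)
    (h : movedGap X Y P Q δ η z ≤ 0) : 1 ≤ (∑ i, δ i) / A + (∑ r, η r) / B := by
  obtain ⟨w, hw, he⟩ := exists_gap_eq hne (z.1 - δ * z.1, z.2 + η * z.2)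
  have h0 : netValue w (z.1 - δ * z.1, z.2 + η * z.2) ≤ 0 := he ▸ h
  have hN : 0 < netValue w z := hg.trans_le (gap_le hw z)
  have h1 : ∀ i, A * (w.1 i * z.1 i) ≤ netValue w z := fun i => by
    have := (hA' i).trans (gap_le hw _)
    rw [← Pi.single_mul_left] at this
    simp only [netValue, dotProduct_sub, dotProduct_single, zero_mul, add_zero] at this ⊢
    linarith
  have h2 : ∀ r, B * (w.2 r * z.2 r) ≤ netValue w z := fun r => by
    have := (hB' r).trans (gap_le hw _)
    rw [← Pi.single_mul_left] at this
    simp only [netValue, dotProduct_add, dotProduct_single, zero_mul, sub_zero] at this ⊢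
    linarith
  have h3 : w.1 ⬝ᵥ (δ * z.1) ≤ (∑ i, δ i) / A * netValue w z := by
    rw [Finset.sum_div, Finset.sum_mul]
    refine Finset.sum_le_sum fun i _ => ?_
    calc w.1 i * (δ i * z.1 i) = δ i / A * (A * (w.1 i * z.1 i)) := by field_simp
      _ ≤ _ := mul_le_mul_of_nonneg_left (h1 i) (div_nonneg (hδ i) hA.le)
  have h4 : w.2 ⬝ᵥ (η * z.2) ≤ (∑ r, η r) / B * netValue w z := by
    rw [Finset.sum_div, Finset.sum_mul]
    refine Finset.sum_le_sum fun r _ => ?_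
    calc w.2 r * (η r * z.2 r) = η r / B * (B * (w.2 r * z.2 r)) := by field_simp
      _ ≤ _ := mul_le_mul_of_nonneg_left (h2 r) (div_nonneg (hη r) hB.le)
  have h5 : netValue w z ≤ w.1 ⬝ᵥ (δ * z.1) + w.2 ⬝ᵥ (η * z.2) := by
    simp only [netValue, dotProduct_sub, dotProduct_add] at h0 ⊢
    linarith
  have h6 : 1 * netValue w z ≤ ((∑ i, δ i) / A + (∑ r, η r) / B) * netValue w z := by
    rw [add_mul]; linarith
  exact le_of_mul_le_mul_right h6 hN

end Moves

/-! ### Elementary bounds for the two efficiency scores -/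

/-- On the line `a / A + b / B = 1` the score is a quotient of affine functions of `b`, hence
monotone, and so it is largest at an end point. -/
theorem sbm_score_le {M N A B a b : ℝ} (hM : 0 < M) (hN : 0 < N) (hA : 0 < A) (hB : 0 < B)
    (ha : 0 ≤ a) (hb : 0 ≤ b) (h : 1 ≤ a / A + b / B) :
    (1 - a / M) * (N / (N + b)) ≤ max (1 - A / M) (N / (N + B)) := by
  set θ := max (1 - A / M) (N / (N + B)) with hθ
  have h1 : 1 - A / M ≤ θ := le_max_left _ _
  have h2 : N ≤ θ * (N + B) := (div_le_iff₀ (by positivity)).1 (le_max_right _ _)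
  have hθ0 : 0 < θ := (by positivity : 0 < N / (N + B)).trans_le (le_max_right _ _)
  rw [← mul_div_assoc, div_le_iff₀ (by positivity)]
  rcases le_total B b with hBb | hbB
  · have e1 : (1 - a / M) * N ≤ N := by
      have : 0 ≤ a / M * N := by positivity
      linarith
    have e2 := mul_le_mul_of_nonneg_left hBb hθ0.le
    linarith
  · obtain ⟨t, rfl⟩ : ∃ t, b = t * B := ⟨b / B, by field_simp⟩
    have ht0 : 0 ≤ t := nonneg_of_mul_nonneg_left hb hB
    have ht1 : t ≤ 1 := le_of_mul_le_mul_right (by linarith) hB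
    rw [mul_div_cancel_right₀ _ hB.ne'] at h
    have e1 : (1 - t) * (A / M) ≤ a / M := by
      rw [← mul_div_assoc]
      refine div_le_div_of_nonneg_right ?_ hM.le
      have := (le_div_iff₀ hA).1 (sub_le_iff_le_add.2 h)
      exact this
    have e2 : 1 - a / M ≤ t + (1 - t) * θ := by
      have := mul_le_mul_of_nonneg_left h1 (sub_nonneg.2 ht1)
      linarith
    have e3 := mul_le_mul_of_nonneg_right e2 hN.le
    have e4 := mul_le_mul_of_nonneg_left h2 ht0
    linarith

/-- On the line `a / A + b / B = 1` the bound `(1 - a / M) * (1 - (b / (1 + b)) / N)` is a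
quasiconvex function of `b`, and so it is largest at an end point. This uses `1 ≤ N`. -/
theorem brwz_score_le {M N A B a b H : ℝ} (hM : 0 < M) (hN : 1 ≤ N) (hA : 0 < A) (hB : 0 < B)
    (ha : 0 ≤ a) (hb : 0 ≤ b) (h : 1 ≤ a / A + b / B) (hH : 0 ≤ H)
    (hHb : H ≤ 1 - b / (1 + b) / N) :
    (1 - a / M) * H ≤ max (1 - A / M) (1 - B / (1 + B) / N) := by
  set θ := max (1 - A / M) (1 - B / (1 + B) / N) with hθ
  have hN0 : 0 < N := by linarith
  have h1 : 1 - A / M ≤ θ := le_max_left _ _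
  have h2 : 1 - B / (1 + B) / N ≤ θ := le_max_right _ _
  have haM : 0 ≤ a / M := by positivity
  rcases le_total B b with hBb | hbB
  · have e1 : (1 - a / M) * H ≤ H := by nlinarith
    have e2 : B / (1 + B) / N ≤ b / (1 + b) / N := by
      refine div_le_div_of_nonneg_right ?_ hN0.le
      rw [div_le_div_iff₀ (by linarith) (by linarith)]
      linarith
    linarith
  · obtain ⟨t, rfl⟩ : ∃ t, b = t * B := ⟨b / B, by field_simp⟩
    have ht0 : 0 ≤ t := nonneg_of_mul_nonneg_left hb hB
    have ht1 : t ≤ 1 := le_of_mul_le_mul_right (by linarith) hB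
    rw [mul_div_cancel_right₀ _ hB.ne'] at h
    have e1 : (1 - t) * (A / M) ≤ a / M := by
      rw [← mul_div_assoc]
      refine div_le_div_of_nonneg_right ?_ hM.le
      exact (le_div_iff₀ hA).1 (sub_le_iff_le_add.2 h)
    have e2 : 1 - a / M ≤ t + (1 - t) * θ := by
      have := mul_le_mul_of_nonneg_left h1 (sub_nonneg.2 ht1)
      linarith
    set Q := t * B / (1 + t * B) / N with hQ
    set R := B / (1 + B) / N with hR
    have hQ0 : 0 ≤ Q := by positivity
    have hQ1 : Q ≤ 1 := by linarith
    have hR1 : R ≤ 1 := by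
      rw [hR, div_div, div_le_one (by positivity)]
      nlinarith
    have hR0 : 0 ≤ R := by positivity
    -- It remains to bound `(t + (1 - t) * θ) * (1 - Q)` by `θ`. The difference is affine in `θ`, so
    -- the smallest possible value `θ = 1 - R` decides, where the claim is the following inequality.
    have key : R * (t + (1 - t) * Q) ≤ Q := by
      have : t + (1 - t) * Q = t * (N * (1 + t * B) + (1 - t) * B) / (N * (1 + t * B)) := by
        rw [hQ]; field_simp
      rw [this, hQ, hR, div_div, div_div, div_mul_div_comm, div_le_div_iff₀ (by positivity)
        (by positivity)]
      have e : (1 - t) * B ≤ N * ((1 - t) * B) :=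
        le_mul_of_one_le_left (mul_nonneg (sub_nonneg.2 ht1) hB.le) hN
      have e' := mul_le_mul_of_nonneg_left e
        (by positivity : 0 ≤ t * B * (N * (1 + t * B)))
      nlinarith
    have e3 : (1 - a / M) * H ≤ (t + (1 - t) * θ) * (1 - Q) := by
      refine (mul_le_mul_of_nonneg_right e2 hH).trans (mul_le_mul_of_nonneg_left hHb ?_)
      have : 0 ≤ θ := by linarith
      have := mul_nonneg (sub_nonneg.2 ht1) this
      linarith
    have e4 : (1 - R) * (t + (1 - t) * Q) ≤ θ * (t + (1 - t) * Q) :=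
      mul_le_mul_of_nonneg_right (by linarith)
        (add_nonneg ht0 (mul_nonneg (sub_nonneg.2 ht1) hQ0))
    nlinarith

/-! ### The optimal values for data with zeros -/

section Slacks

variable {l : ℕ}

theorem posIdx_apply {z : Fin l → ℝ} {i : Fin l} : i ∈ posIdx z ↔ 0 < z i := by
  simp [posIdx]

theorem sum_posIdx_single {z : Fin l → ℝ} (hz : 0 ≤ z) (δ : Fin l → ℝ) :
    ∑ i ∈ posIdx z, (Pi.single i (δ i * z i) : Fin l → ℝ) = δ * z := by
  have h : ∑ i ∈ posIdx z, (Pi.single i (δ i * z i) : Fin l → ℝ) =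
      ∑ i, Pi.single i ((δ * z) i) := by
    refine Finset.sum_subset (Finset.subset_univ _) fun i _ hi => ?_
    have : z i = 0 := le_antisymm (not_lt.1 fun h => hi (posIdx_apply.2 h)) (hz i)
    simp [this]
  rw [h, Finset.univ_sum_single]

theorem contract_eq {x : Fin l → ℝ} (hx : 0 ≤ x) (δ : Fin l → ℝ) :
    contract x δ = x - δ * x := by
  rw [contract, sum_posIdx_single hx]

theorem expand_eq {y : Fin l → ℝ} (hy : 0 ≤ y) (η : Fin l → ℝ) :
    expand y η = y + η * y := by
  rw [expand, sum_posIdx_single hy]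

theorem sum_posIdx {z δ : Fin l → ℝ} (hδ : δ ∈ relSlack z) : ∑ i ∈ posIdx z, δ i = ∑ i, δ i :=
  Finset.sum_subset (Finset.subset_univ _) fun i _ hi => hδ.2 i hi

theorem single_mem_relSlack {z : Fin l → ℝ} {i : Fin l} (hi : 0 < z i) {c : ℝ} (hc : 0 ≤ c) :
    Pi.single i c ∈ relSlack z :=
  ⟨Pi.single_nonneg.2 hc, fun k hk => Pi.single_eq_of_ne (by
    rintro rfl; exact hk (posIdx_apply.2 hi)) _⟩

theorem zero_mem_relSlack (z : Fin l → ℝ) : 0 ∈ relSlack z := ⟨le_rfl, fun _ _ => rfl⟩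

theorem gMinusNat_eq {x δ : Fin l → ℝ} (hδ : δ ∈ relSlack x) :
    gMinusNat x δ = 1 - (∑ i, δ i) / l := by
  rw [gMinusNat, sum_posIdx hδ]; ring

theorem gPlusNat_eq {y η : Fin l → ℝ} (hη : η ∈ relSlack y) :
    gPlusNat y η = l / (l + ∑ r, η r) := by
  rw [gPlusNat, sum_posIdx hη]

theorem hPlusNat_eq {y η : Fin l → ℝ} (hη : η ∈ relSlack y) :
    hPlusNat y η = 1 - (∑ r, η r / (1 + η r)) / l := by
  have h : ∑ r ∈ posIdx y, 1 / (1 + η r) = (posIdx y).card - ∑ r, η r / (1 + η r) := by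
    have h1 : ∑ r ∈ posIdx y, η r / (1 + η r) = ∑ r, η r / (1 + η r) :=
      Finset.sum_subset (Finset.subset_univ _) fun r _ hr => by simp [hη.2 r hr]
    rw [← h1, Finset.cast_card, ← Finset.sum_sub_distrib]
    refine Finset.sum_congr rfl fun r _ => ?_
    have : 0 ≤ η r := hη.1 r
    field_simp
    ring
  rw [hPlusNat, h]; ring

theorem sum_div_one_add_sum_le {η : Fin l → ℝ} (hη : 0 ≤ η) :
    (∑ r, η r) / (1 + ∑ r, η r) ≤ ∑ r, η r / (1 + η r) := by
  rw [Finset.sum_div]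
  refine Finset.sum_le_sum fun r _ => ?_
  have h0 : 0 ≤ η r := hη r
  exact div_le_div_of_nonneg_left h0 (by linarith)
    (add_le_add_right (Finset.single_le_sum (fun i _ => hη i) (Finset.mem_univ r)) 1)

theorem sum_div_one_add_le {η : Fin l → ℝ} (hη : 0 ≤ η) : ∑ r, η r / (1 + η r) ≤ l := by
  have : ∑ r, η r / (1 + η r) ≤ ∑ _r : Fin l, (1 : ℝ) := Finset.sum_le_sum fun r _ => by
    have h0 : 0 ≤ η r := hη r
    exact div_le_one_of_le₀ (by linarith) (by linarith)
  simpa using this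

end Slacks

section Optimum

variable {n m s p q : ℕ} {X : Fin n → Fin m → ℝ} {Y : Fin n → Fin s → ℝ}
  {P : Matrix (Fin m) (Fin p) ℝ} {Q : Matrix (Fin s) (Fin q) ℝ}
  {x : Fin m → ℝ} {y : Fin s → ℝ} {A B : ℝ}

theorem moved_mem_strongFrontier_iff [Nonempty (Fin n)] [Nonempty (Fin m)]
    (hX : ∀ j, 0 ≤ X j ∧ X j ≠ 0)
    (hY : ∀ j, 0 ≤ Y j ∧ Y j ≠ 0) (hP : InputCond P) (hQ : OutputCond Q)
    (hv : ∃ v ∈ weightCone P, v ≠ 0) (hz : (x, y) ∈ dataSet X Y P Q) {δ : Fin m → ℝ}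
    {η : Fin s → ℝ} (hη : 0 ≤ η) :
    (contract x δ, expand y η) ∈ strongFrontier X Y P Q ↔ movedGap X Y P Q δ η (x, y) = 0 := by
  rw [contract_eq hz.1, expand_eq hz.2.2.1]
  exact mem_strongFrontier_iff hX hY hP hQ (normalizedMultipliers_nonempty hX hP hQ hv)
    (add_mul_nonneg hz.2.2.1 hη) (add_mul_ne_zero hz.2.2.1 hz.2.2.2.1 hη)

/-- Slacks leading to the frontier either start on it or satisfy the bound of
`one_le_sum_div_add_sum_div`. -/
theorem eq_zero_or_one_le [Nonempty (Fin n)] [Nonempty (Fin m)]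
    (hX : ∀ j, 0 ≤ X j ∧ X j ≠ 0)
    (hY : ∀ j, 0 ≤ Y j ∧ Y j ≠ 0) (hP : InputCond P) (hQ : OutputCond Q)
    (hv : ∃ v ∈ weightCone P, v ≠ 0) (hz : (x, y) ∈ dataSet X Y P Q)
    (hA : IsInputDist X Y P Q (x, y) A) (hB : IsOutputDist X Y P Q (x, y) B) {δ : Fin m → ℝ}
    {η : Fin s → ℝ} (hδ : 0 ≤ δ) (hη : 0 ≤ η) (h : movedGap X Y P Q δ η (x, y) = 0) :
    (A = 0 ∧ B = 0) ∨ (0 < A ∧ 0 < B ∧ 1 ≤ (∑ i, δ i) / A + (∑ r, η r) / B) := by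
  have hA0 := (inputAxisFamily hX hY hP hQ hv).dist_eq_zero_iff hz hA
  have hB0 := (outputAxisFamily hX hY hP hQ hv).dist_eq_zero_iff hz hB
  have hne := normalizedMultipliers_nonempty (X := X) (Y := Y) hX hP hQ hv
  by_cases hg : gap X Y P Q (x, y) = 0
  · exact .inl ⟨hA0.2 hg, hB0.2 hg⟩
  · have hAp : 0 < A := lt_of_le_of_ne hA.1 fun e => hg (hA0.1 e.symm)
    have hBp : 0 < B := lt_of_le_of_ne hB.1 fun e => hg (hB0.1 e.symm)
    have hgp : 0 < gap X Y P Q (x, y) :=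
      lt_of_le_of_ne ((mem_pps_iff_gap_nonneg hne).1 hz.2.2.2.2) (Ne.symm hg)
    exact .inr ⟨hAp, hBp, one_le_sum_div_add_sum_div hne hgp hAp hBp hA.2.1 hB.2.1 hδ hη h.le⟩

theorem isLeast_inputValuesNat [Nonempty (Fin n)] [Nonempty (Fin m)]
    (hX : ∀ j, 0 ≤ X j ∧ X j ≠ 0)
    (hY : ∀ j, 0 ≤ Y j ∧ Y j ≠ 0) (hP : InputCond P) (hQ : OutputCond Q)
    (hv : ∃ v ∈ weightCone P, v ≠ 0) (hz : (x, y) ∈ dataSet X Y P Q)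
    (hA : IsInputDist X Y P Q (x, y) A) (hB : IsOutputDist X Y P Q (x, y) B) :
    IsLeast (inputValuesNat X Y P Q x y) A := by
  have hy : y = expand y 0 := by simp [expand_eq hz.2.2.1]
  constructor
  · obtain ⟨hA0, -, i, hi, h⟩ := hA
    have hs := single_mem_relSlack hi hA0
    refine ⟨_, hs, ?_, ?_⟩
    · have := (moved_mem_strongFrontier_iff hX hY hP hQ hv hz le_rfl).2 h
      rwa [← hy] at this
    · rw [sum_posIdx hs, Fintype.sum_pi_single']
  · rintro c ⟨δ, hδ, hf, rfl⟩
    rw [hy, moved_mem_strongFrontier_iff hX hY hP hQ hv hz le_rfl] at hf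
    rw [sum_posIdx hδ]
    rcases eq_zero_or_one_le hX hY hP hQ hv hz hA hB hδ.1 le_rfl hf with ⟨h0, -⟩ | ⟨hAp, -, h⟩
    · exact h0 ▸ Finset.sum_nonneg fun i _ => hδ.1 i
    · simp only [Pi.zero_apply, Finset.sum_const_zero, zero_div, add_zero] at h
      rwa [one_le_div hAp] at h

theorem isLeast_outputValuesNat [Nonempty (Fin n)] [Nonempty (Fin m)]
    (hX : ∀ j, 0 ≤ X j ∧ X j ≠ 0)
    (hY : ∀ j, 0 ≤ Y j ∧ Y j ≠ 0) (hP : InputCond P) (hQ : OutputCond Q)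
    (hv : ∃ v ∈ weightCone P, v ≠ 0) (hz : (x, y) ∈ dataSet X Y P Q)
    (hA : IsInputDist X Y P Q (x, y) A) (hB : IsOutputDist X Y P Q (x, y) B) :
    IsLeast (outputValuesNat X Y P Q x y) B := by
  have hx : x = contract x 0 := by simp [contract_eq hz.1]
  constructor
  · obtain ⟨hB0, -, r, hr, h⟩ := hB
    have hs := single_mem_relSlack hr hB0
    refine ⟨_, hs, ?_, ?_⟩
    · have := (moved_mem_strongFrontier_iff hX hY hP hQ hv hz hs.1).2 h
      rwa [← hx] at this
    · rw [sum_posIdx hs, Fintype.sum_pi_single']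
  · rintro c ⟨η, hη, hf, rfl⟩
    rw [hx, moved_mem_strongFrontier_iff hX hY hP hQ hv hz hη.1] at hf
    rw [sum_posIdx hη]
    rcases eq_zero_or_one_le hX hY hP hQ hv hz hA hB le_rfl hη.1 hf with ⟨-, h0⟩ | ⟨-, hBp, h⟩
    · exact h0 ▸ Finset.sum_nonneg fun r _ => hη.1 r
    · simp only [Pi.zero_apply, Finset.sum_const_zero, zero_div, zero_add] at h
      rwa [one_le_div hBp] at h

theorem one_le_cast_of_ne_zero {l : ℕ} {z : Fin l → ℝ} (hz : z ≠ 0) : 1 ≤ (l : ℝ) := by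
  obtain ⟨i, -⟩ := Function.ne_iff.1 hz
  exact_mod_cast i.pos

/-- The best slacks-based score is attained by a slack along a single coordinate. -/
theorem isGreatest_sbmValuesNat [Nonempty (Fin n)] [Nonempty (Fin m)]
    (hX : ∀ j, 0 ≤ X j ∧ X j ≠ 0)
    (hY : ∀ j, 0 ≤ Y j ∧ Y j ≠ 0) (hP : InputCond P) (hQ : OutputCond Q)
    (hv : ∃ v ∈ weightCone P, v ≠ 0) (hz : (x, y) ∈ dataSet X Y P Q)
    (hA : IsInputDist X Y P Q (x, y) A) (hB : IsOutputDist X Y P Q (x, y) B) :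
    IsGreatest (sbmValuesNat X Y P Q x y) (max (1 - A / m) (s / (s + B))) := by
  have hm := one_le_cast_of_ne_zero hz.2.1
  have hs := one_le_cast_of_ne_zero hz.2.2.2.1
  constructor
  · rcases max_choice (1 - A / m) (s / (s + B)) with e | e <;> rw [e]
    · obtain ⟨hA0, -, i, hi, h⟩ := hA
      refine ⟨_, single_mem_relSlack hi hA0, 0, zero_mem_relSlack y,
        (moved_mem_strongFrontier_iff hX hY hP hQ hv hz le_rfl).2 h, ?_⟩
      rw [gMinusNat_eq (single_mem_relSlack hi hA0), gPlusNat_eq (zero_mem_relSlack y),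
        Fintype.sum_pi_single']
      simp only [Pi.zero_apply, Finset.sum_const_zero, add_zero]
      rw [div_self (by linarith), mul_one]
    · obtain ⟨hB0, -, r, hr, h⟩ := hB
      refine ⟨0, zero_mem_relSlack x, _, single_mem_relSlack hr hB0,
        (moved_mem_strongFrontier_iff hX hY hP hQ hv hz (single_mem_relSlack hr hB0).1).2 h, ?_⟩
      rw [gMinusNat_eq (zero_mem_relSlack x), gPlusNat_eq (single_mem_relSlack hr hB0),
        Fintype.sum_pi_single']
      simp
  · rintro c ⟨δ, hδ, η, hη, hf, rfl⟩
    rw [moved_mem_strongFrontier_iff hX hY hP hQ hv hz hη.1] at hf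
    rw [gMinusNat_eq hδ, gPlusNat_eq hη]
    have ha : 0 ≤ ∑ i, δ i := Finset.sum_nonneg fun i _ => hδ.1 i
    have hb : 0 ≤ ∑ r, η r := Finset.sum_nonneg fun r _ => hη.1 r
    rcases eq_zero_or_one_le hX hY hP hQ hv hz hA hB hδ.1 hη.1 hf with ⟨rfl, rfl⟩ | ⟨hAp, hBp, h⟩
    · refine le_max_of_le_left ?_
      rw [zero_div, sub_zero]
      refine mul_le_one₀ (sub_le_self _ (by positivity)) (by positivity)
        (div_le_one_of_le₀ (by linarith) (by positivity))
    · exact sbm_score_le (by linarith) (by linarith) hAp hBp ha hb h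

/-- The best BRWZ score is attained by a slack along a single coordinate. -/
theorem isGreatest_brwzValuesNat [Nonempty (Fin n)] [Nonempty (Fin m)]
    (hX : ∀ j, 0 ≤ X j ∧ X j ≠ 0)
    (hY : ∀ j, 0 ≤ Y j ∧ Y j ≠ 0) (hP : InputCond P) (hQ : OutputCond Q)
    (hv : ∃ v ∈ weightCone P, v ≠ 0) (hz : (x, y) ∈ dataSet X Y P Q)
    (hA : IsInputDist X Y P Q (x, y) A) (hB : IsOutputDist X Y P Q (x, y) B) :
    IsGreatest (brwzValuesNat X Y P Q x y) (max (1 - A / m) (1 - B / (1 + B) / s)) := by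
  have hm := one_le_cast_of_ne_zero hz.2.1
  have hs := one_le_cast_of_ne_zero hz.2.2.2.1
  constructor
  · rcases max_choice (1 - A / m) (1 - B / (1 + B) / s) with e | e <;> rw [e]
    · obtain ⟨hA0, -, i, hi, h⟩ := hA
      refine ⟨_, single_mem_relSlack hi hA0, 0, zero_mem_relSlack y,
        (moved_mem_strongFrontier_iff hX hY hP hQ hv hz le_rfl).2 h, ?_⟩
      rw [gMinusNat_eq (single_mem_relSlack hi hA0), hPlusNat_eq (zero_mem_relSlack y),
        Fintype.sum_pi_single']
      simp
    · obtain ⟨hB0, -, r, hr, h⟩ := hB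
      refine ⟨0, zero_mem_relSlack x, _, single_mem_relSlack hr hB0,
        (moved_mem_strongFrontier_iff hX hY hP hQ hv hz (single_mem_relSlack hr hB0).1).2 h, ?_⟩
      have hsum : ∑ k, (Pi.single r B : Fin s → ℝ) k / (1 + (Pi.single r B : Fin s → ℝ) k) =
          B / (1 + B) := by
        rw [Finset.sum_eq_single r (fun k _ hk => by simp [hk]) (by simp), Pi.single_eq_same]
      rw [gMinusNat_eq (zero_mem_relSlack x), hPlusNat_eq (single_mem_relSlack hr hB0), hsum]
      simp
  · rintro c ⟨δ, hδ, η, hη, hf, rfl⟩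
    rw [moved_mem_strongFrontier_iff hX hY hP hQ hv hz hη.1] at hf
    rw [gMinusNat_eq hδ, hPlusNat_eq hη]
    have ha : 0 ≤ ∑ i, δ i := Finset.sum_nonneg fun i _ => hδ.1 i
    have hb : 0 ≤ ∑ r, η r := Finset.sum_nonneg fun r _ => hη.1 r
    have hH : 0 ≤ 1 - (∑ r, η r / (1 + η r)) / s :=
      sub_nonneg.2 (div_le_one_of_le₀ (sum_div_one_add_le hη.1) (by linarith))
    have hHb : 1 - (∑ r, η r / (1 + η r)) / s ≤ 1 - (∑ r, η r) / (1 + ∑ r, η r) / s :=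
      sub_le_sub_left (div_le_div_of_nonneg_right (sum_div_one_add_sum_le hη.1) (by linarith)) 1
    rcases eq_zero_or_one_le hX hY hP hQ hv hz hA hB hδ.1 hη.1 hf with ⟨rfl, rfl⟩ | ⟨hAp, hBp, h⟩
    · refine le_max_of_le_left ?_
      rw [zero_div, sub_zero]
      exact mul_le_one₀ (sub_le_self _ (by positivity)) hH
        (hHb.trans (sub_le_self _ (by positivity)))
    · exact brwz_score_le (by linarith) hs hAp hBp ha hb h hH hHb

end Optimum

/-! ### Positive data as a special case of data with zeros -/

section PositiveData

variable {l : ℕ}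

theorem posIdx_eq_univ {z : Fin l → ℝ} (hz : z ∈ positive l) : posIdx z = Finset.univ :=
  Finset.eq_univ_of_forall fun i => posIdx_apply.2 (hz i)

theorem div_mem_relSlack {z d : Fin l → ℝ} (hz : z ∈ positive l) (hd : 0 ≤ d) :
    d / z ∈ relSlack z :=
  ⟨fun i => div_nonneg (hd i) (hz i).le, fun i hi => absurd (posIdx_apply.2 (hz i)) hi⟩

theorem div_mul_cancel_of_positive {z : Fin l → ℝ} (hz : z ∈ positive l) (d : Fin l → ℝ) :
    d / z * z = d :=
  funext fun i => div_mul_cancel₀ _ (hz i).ne'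

theorem mul_div_cancel_of_positive {z : Fin l → ℝ} (hz : z ∈ positive l) (δ : Fin l → ℝ) :
    δ * z / z = δ :=
  funext fun i => mul_div_cancel_right₀ _ (hz i).ne'

/-- For positive data absolute slacks `d` and relative slacks `d / z` correspond to each other. -/
theorem exists_slack_iff {z : Fin l → ℝ} (hz : z ∈ positive l) (p : (Fin l → ℝ) → Prop) :
    (∃ d, 0 ≤ d ∧ p d) ↔ ∃ δ ∈ relSlack z, p (δ * z) := by
  constructor
  · rintro ⟨d, hd, h⟩
    exact ⟨d / z, div_mem_relSlack hz hd, by rwa [div_mul_cancel_of_positive hz]⟩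
  · rintro ⟨δ, hδ, h⟩
    exact ⟨δ * z, mul_nonneg hδ.1 fun i => (hz i).le, h⟩

theorem gMinus_mul {x : Fin l → ℝ} (hx : x ∈ positive l) (δ : Fin l → ℝ) :
    gMinus x (δ * x) = gMinusNat x δ := by
  have h : ∀ i, (δ * x) i / x i = δ i := congrFun (mul_div_cancel_of_positive hx δ)
  simp only [gMinus, gMinusNat, h, posIdx_eq_univ hx]

theorem gPlus_mul {y : Fin l → ℝ} (hy : y ∈ positive l) (η : Fin l → ℝ) :
    gPlus y (η * y) = gPlusNat y η := by
  have h : ∀ i, (η * y) i / y i = η i := congrFun (mul_div_cancel_of_positive hy η)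
  simp only [gPlus, gPlusNat, h, posIdx_eq_univ hy, Finset.sum_add_distrib]
  simp

theorem hPlus_mul {y : Fin l → ℝ} (hy : y ∈ positive l) (hl : y ≠ 0) (η : Fin l → ℝ) :
    hPlus y (η * y) = hPlusNat y η := by
  have h : ∀ i, (η * y) i / y i = η i := congrFun (mul_div_cancel_of_positive hy η)
  have hl := one_le_cast_of_ne_zero hl
  have hl' : (1 / (l : ℝ)) * l = 1 := one_div_mul_cancel (by linarith)
  simp only [hPlus, hPlusNat, h, posIdx_eq_univ hy, Finset.card_univ, Fintype.card_fin, hl']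
  ring

variable {n m s p q : ℕ} {X : Fin n → Fin m → ℝ} {Y : Fin n → Fin s → ℝ}
  {P : Matrix (Fin m) (Fin p) ℝ} {Q : Matrix (Fin s) (Fin q) ℝ}
  {x : Fin m → ℝ} {y : Fin s → ℝ}

theorem inputValues_eq (hx : x ∈ positive m) :
    inputValues X Y P Q x y = inputValuesNat X Y P Q x y := by
  ext c
  have hx0 : (0 : Fin m → ℝ) ≤ x := fun i => (hx i).le
  refine (exists_slack_iff hx fun d => (x - d, y) ∈ strongFrontier X Y P Q ∧
    c = ∑ i, d i / x i).trans (exists_congr fun δ => and_congr_right fun _ => ?_)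
  have h : ∀ i, (δ * x) i / x i = δ i := congrFun (mul_div_cancel_of_positive hx δ)
  simp only [contract_eq hx0, h, posIdx_eq_univ hx]

theorem outputValues_eq (hy : y ∈ positive s) :
    outputValues X Y P Q x y = outputValuesNat X Y P Q x y := by
  ext c
  have hy0 : (0 : Fin s → ℝ) ≤ y := fun i => (hy i).le
  refine (exists_slack_iff hy fun d => (x, y + d) ∈ strongFrontier X Y P Q ∧
    c = ∑ r, d r / y r).trans (exists_congr fun η => and_congr_right fun _ => ?_)
  have h : ∀ r, (η * y) r / y r = η r := congrFun (mul_div_cancel_of_positive hy η)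
  simp only [expand_eq hy0, h, posIdx_eq_univ hy]

theorem sbmValues_eq (hx : x ∈ positive m) (hy : y ∈ positive s) :
    sbmValues X Y P Q x y = sbmValuesNat X Y P Q x y := by
  ext c
  have hx0 : (0 : Fin m → ℝ) ≤ x := fun i => (hx i).le
  have hy0 : (0 : Fin s → ℝ) ≤ y := fun i => (hy i).le
  have h := exists_slack_iff hx fun d => ∃ e, 0 ≤ e ∧ (x - d, y + e) ∈ strongFrontier X Y P Q ∧
    c = gMinus x d * gPlus y e
  refine Iff.trans (by simp only [sbmValues, Set.mem_ofPred_eq, exists_and_left]) (h.trans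
    (exists_congr fun δ => and_congr_right fun _ => (exists_slack_iff hy _).trans
      (exists_congr fun η => and_congr_right fun _ => ?_)))
  rw [contract_eq hx0, expand_eq hy0, gMinus_mul hx, gPlus_mul hy]

theorem brwzValues_eq (hx : x ∈ positive m) (hy : y ∈ positive s) (hs : y ≠ 0) :
    brwzValues X Y P Q x y = brwzValuesNat X Y P Q x y := by
  ext c
  have hx0 : (0 : Fin m → ℝ) ≤ x := fun i => (hx i).le
  have hy0 : (0 : Fin s → ℝ) ≤ y := fun i => (hy i).le
  have h := exists_slack_iff hx fun d => ∃ e, 0 ≤ e ∧ (x - d, y + e) ∈ strongFrontier X Y P Q ∧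
    c = gMinus x d * hPlus y e
  refine Iff.trans (by simp only [brwzValues, Set.mem_ofPred_eq, exists_and_left]) (h.trans
    (exists_congr fun δ => and_congr_right fun _ => (exists_slack_iff hy _).trans
      (exists_congr fun η => and_congr_right fun _ => ?_)))
  rw [contract_eq hx0, expand_eq hy0, gMinus_mul hx, hPlus_mul hy hs]

end PositiveData

/-! ### Perturbations of the data -/

section Perturbation

variable {n m s p q : ℕ} {X : Fin n → Fin m → ℝ} {Y : Fin n → Fin s → ℝ}
  {P : Matrix (Fin m) (Fin p) ℝ} {Q : Matrix (Fin s) (Fin q) ℝ}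
  {x : Fin m → ℝ} {y : Fin s → ℝ}

theorem add_mem_positive {l : ℕ} {z ε : Fin l → ℝ} (hz : 0 ≤ z) (h0 : ∀ i ∈ posIdx z, ε i = 0)
    (h1 : ∀ i, i ∉ posIdx z → 0 < ε i) : z + ε ∈ positive l := fun i => by
  rw [Pi.add_apply]
  by_cases hi : i ∈ posIdx z
  · rw [h0 i hi, add_zero]; exact posIdx_apply.1 hi
  · exact add_pos_of_nonneg_of_pos (hz i) (h1 i hi)

theorem ne_zero_of_mem_positive {l : ℕ} {z z' : Fin l → ℝ} (hz : z ∈ positive l) (h : z' ≠ 0) :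
    z ≠ 0 := by
  obtain ⟨i, -⟩ := Function.ne_iff.1 h
  rintro rfl
  exact absurd (hz i) (lt_irrefl _)

theorem perturbed_positive (hx : 0 ≤ x) (hy : 0 ≤ y) {ε : (Fin m → ℝ) × (Fin s → ℝ)}
    (hε : ε ∈ admissible X Y P Q x y) : x + ε.1 ∈ positive m ∧ y + ε.2 ∈ positive s :=
  ⟨add_mem_positive hx hε.1.1 hε.1.2.1, add_mem_positive hy hε.1.2.2.1 hε.1.2.2.2⟩

theorem perturbed_mem_dataSet (hx : 0 ≤ x) (hx0 : x ≠ 0) (hy : 0 ≤ y) (hy0 : y ≠ 0)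
    {ε : (Fin m → ℝ) × (Fin s → ℝ)} (hε : ε ∈ admissible X Y P Q x y) :
    (x + ε.1, y + ε.2) ∈ dataSet X Y P Q := by
  obtain ⟨h1, h2⟩ := perturbed_positive hx hy hε
  exact ⟨fun i => (h1 i).le, ne_zero_of_mem_positive h1 hx0, fun r => (h2 r).le,
    ne_zero_of_mem_positive h2 hy0, hε.2⟩

theorem tendsto_perturbed (hx : 0 ≤ x) (hx0 : x ≠ 0) (hy : 0 ≤ y) (hy0 : y ≠ 0) :
    Tendsto (fun ε : (Fin m → ℝ) × (Fin s → ℝ) => (x + ε.1, y + ε.2))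
      (𝓝[admissible X Y P Q x y] 0) (𝓝[dataSet X Y P Q] (x, y)) := by
  refine tendsto_nhdsWithin_iff.2 ⟨?_, eventually_mem_nhdsWithin.mono fun ε hε =>
    perturbed_mem_dataSet hx hx0 hy hy0 hε⟩
  have h : Continuous fun ε : (Fin m → ℝ) × (Fin s → ℝ) => (x + ε.1, y + ε.2) := by fun_prop
  simpa using (h.tendsto 0).mono_left nhdsWithin_le_nhds

/-- The indicator of the coordinates that are not positive. -/
def zeroIndicator {l : ℕ} (z : Fin l → ℝ) : Fin l → ℝ := fun i => if 0 < z i then 0 else 1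

theorem zeroIndicator_nonneg {l : ℕ} (z : Fin l → ℝ) : 0 ≤ zeroIndicator z := fun i => by
  unfold zeroIndicator; split_ifs <;> simp

theorem smul_zeroIndicator_mem_perturb {t t' : ℝ} (ht : 0 < t) (ht' : 0 < t') :
    (t • zeroIndicator x, t' • zeroIndicator y) ∈ perturb x y := by
  refine ⟨fun i hi => ?_, fun i hi => ?_, fun i hi => ?_, fun i hi => ?_⟩ <;>
    rw [posIdx_apply] at hi <;> simp [zeroIndicator, hi, ht, ht']

/-- Perturbing along a ray that stays in the production possibility set. -/
theorem neBot_admissible_of_eventually {c : ℝ} (hc : 0 < c)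
    (h : ∀ᶠ t : ℝ in 𝓝[>] 0,
      (x + t • zeroIndicator x, y + (t * c) • zeroIndicator y) ∈ pps X Y P Q) :
    (𝓝[admissible X Y P Q x y] (0 : (Fin m → ℝ) × (Fin s → ℝ))).NeBot := by
  rw [← mem_closure_iff_nhdsWithin_neBot]
  have hcont : Continuous fun t : ℝ => (t • zeroIndicator x, (t * c) • zeroIndicator y) := by
    fun_prop
  refine mem_closure_of_tendsto (b := 𝓝[>] (0 : ℝ))
    (f := fun t : ℝ => (t • zeroIndicator x, (t * c) • zeroIndicator y)) ?_ ?_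
  · have h0 := (hcont.tendsto 0).mono_left (nhdsWithin_le_nhds (s := Set.Ioi 0))
    simpa only [zero_mul, zero_smul, Prod.mk_zero_zero] using h0
  · filter_upwards [h, self_mem_nhdsWithin] with t ht ht0
    exact ⟨smul_zeroIndicator_mem_perturb ht0 (mul_pos ht0 hc), ht⟩

theorem add_smul_mem_pps {z z' : (Fin m → ℝ) × (Fin s → ℝ)} (hz : z ∈ pps X Y P Q)
    (hz' : z' ∈ pps X Y P Q) {t : ℝ} (ht : 0 ≤ t) : z + t • z' ∈ pps X Y P Q := by
  rw [mem_pps_iff] at hz hz' ⊢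
  intro w hw
  have h1 := hz w hw
  have h2 := mul_nonneg ht (hz' w hw)
  simp only [netValue, Prod.fst_add, Prod.snd_add, Prod.smul_fst, Prod.smul_snd, dotProduct_add,
    dotProduct_smul, smul_eq_mul] at h1 h2 ⊢
  linarith

theorem neBot_admissible [Nonempty (Fin n)] (hX : ∀ j, 0 ≤ X j ∧ X j ≠ 0)
    (hY : ∀ j, 0 ≤ Y j ∧ Y j ≠ 0) (hP : InputCond P) (hQ : OutputCond Q)
    (hx0 : x ≠ 0) (hy : 0 ≤ y) (hy0 : y ≠ 0) (hT : (x, y) ∈ pps X Y P Q)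
    (h : (∃ i, x i = 0) ∨ (∀ r, 0 < y r) ∨ (x, y) ∉ strongFrontier X Y P Q) :
    (𝓝[admissible X Y P Q x y] (0 : (Fin m → ℝ) × (Fin s → ℝ))).NeBot := by
  by_cases hv : ∃ v ∈ weightCone P, v ≠ 0
  swap
  · refine neBot_admissible_of_eventually one_pos (Eventually.of_forall fun t => ?_)
    rw [pps_eq_univ hY hQ hv]
    trivial
  have : Nonempty (Fin m) := by
    obtain ⟨i, -⟩ := Function.ne_iff.1 hx0
    exact ⟨i⟩
  have hne := normalizedMultipliers_nonempty (X := X) (Y := Y) hX hP hQ hv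
  rcases h with ⟨i, hi⟩ | h | h
  · -- Some small increase of the zero outputs is feasible with unit amounts of the zero inputs.
    have hgap : 0 < gap X Y P Q (zeroIndicator x, (0 : ℝ) • zeroIndicator y) := by
      obtain ⟨w, hw, he⟩ := exists_gap_eq hne (zeroIndicator x, (0 : ℝ) • zeroIndicator y)
      rw [he]
      have hw0 : w ≠ 0 := by rintro rfl; simpa using hw.2
      have hpos := dotProduct_pos_of_pos (input_pos_of_mem_multiplierCone hY hP hQ hw.1 hw0)
        (zeroIndicator_nonneg x) (fun h0 => by simpa [zeroIndicator, hi] using congrFun h0 i)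
      simpa [netValue] using hpos
    have hcont : Continuous fun c : ℝ => (zeroIndicator x, c • zeroIndicator y) := by fun_prop
    have hev : ∀ᶠ c : ℝ in 𝓝[>] 0, 0 < gap X Y P Q (zeroIndicator x, c • zeroIndicator y) :=
      (((continuous_gap.comp hcont).tendsto 0).mono_left nhdsWithin_le_nhds).eventually_const_lt
        hgap
    obtain ⟨c, hc, hc0⟩ : ∃ c, 0 < gap X Y P Q (zeroIndicator x, c • zeroIndicator y) ∧ 0 < c :=
      (hev.and self_mem_nhdsWithin).exists
    have hin : (zeroIndicator x, c • zeroIndicator y) ∈ pps X Y P Q :=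
      (mem_pps_iff_gap_nonneg hne).2 (le_of_lt hc)
    refine neBot_admissible_of_eventually hc0 ?_
    filter_upwards [self_mem_nhdsWithin] with t ht
    rw [mul_smul]
    exact add_smul_mem_pps hT hin (le_of_lt ht)
  · refine neBot_admissible_of_eventually one_pos ?_
    filter_upwards [self_mem_nhdsWithin] with t ht
    have hy' : zeroIndicator y = 0 := funext fun r => if_pos (h r)
    rw [hy', smul_zero, add_zero]
    rw [mem_pps_iff] at hT ⊢
    exact fun w hw => (hT w hw).trans (netValue_anti (z := (x + t • zeroIndicator x, y))
      (z' := (x, y)) hw (le_add_of_nonneg_right (smul_nonneg (le_of_lt ht)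
        (zeroIndicator_nonneg x))) (le_refl y))
  · refine neBot_admissible_of_eventually one_pos ?_
    have hg : 0 < gap X Y P Q (x, y) :=
      lt_of_le_of_ne ((mem_pps_iff_gap_nonneg hne).1 hT) fun e =>
        h ((mem_strongFrontier_iff hX hY hP hQ hne hy hy0).2 e.symm)
    have hcont : Continuous fun t : ℝ =>
        (x + t • zeroIndicator x, y + (t * 1) • zeroIndicator y) := by fun_prop
    refine (((continuous_gap (X := X) (Y := Y) (P := P) (Q := Q)).comp hcont).tendsto 0
      |>.mono_left nhdsWithin_le_nhds |>.eventually_const_lt (u := 0) (by simpa using hg)).mono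
        fun t ht => (mem_pps_iff_gap_nonneg hne).2 (le_of_lt ht)

end Perturbation

/-! ### Continuity of the measures -/

section Continuity

variable {n m s p q : ℕ} {X : Fin n → Fin m → ℝ} {Y : Fin n → Fin s → ℝ}
  {P : Matrix (Fin m) (Fin p) ℝ} {Q : Matrix (Fin s) (Fin q) ℝ}

/-- The minima are the coordinate distances, and the two maxima are functions of them. -/
theorem measures_of_mem_dataSet [Nonempty (Fin n)] [Nonempty (Fin m)]
    (hX : ∀ j, 0 ≤ X j ∧ X j ≠ 0)
    (hY : ∀ j, 0 ≤ Y j ∧ Y j ≠ 0) (hP : InputCond P) (hQ : OutputCond Q)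
    (hv : ∃ v ∈ weightCone P, v ≠ 0) {z : (Fin m → ℝ) × (Fin s → ℝ)}
    (hz : z ∈ dataSet X Y P Q) :
    IsInputDist X Y P Q z (DMinusNat X Y P Q z.1 z.2) ∧
    IsOutputDist X Y P Q z (DPlusNat X Y P Q z.1 z.2) ∧
    FSNat X Y P Q z.1 z.2 = max (1 - DMinusNat X Y P Q z.1 z.2 / m)
      (s / (s + DPlusNat X Y P Q z.1 z.2)) ∧
    FBNat X Y P Q z.1 z.2 = max (1 - DMinusNat X Y P Q z.1 z.2 / m)
      (1 - DPlusNat X Y P Q z.1 z.2 / (1 + DPlusNat X Y P Q z.1 z.2) / s) := by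
  obtain ⟨A, hA⟩ := (inputAxisFamily hX hY hP hQ hv).exists_isAxisDist hz
  obtain ⟨B, hB⟩ := (outputAxisFamily hX hY hP hQ hv).exists_isAxisDist hz
  obtain rfl : DMinusNat X Y P Q z.1 z.2 = A :=
    (isLeast_inputValuesNat hX hY hP hQ hv hz hA hB).csInf_eq
  obtain rfl : DPlusNat X Y P Q z.1 z.2 = B :=
    (isLeast_outputValuesNat hX hY hP hQ hv hz hA hB).csInf_eq
  exact ⟨hA, hB, (isGreatest_sbmValuesNat hX hY hP hQ hv hz hA hB).csSup_eq,
    (isGreatest_brwzValuesNat hX hY hP hQ hv hz hA hB).csSup_eq⟩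

theorem measures_attained [Nonempty (Fin n)] [Nonempty (Fin m)]
    (hX : ∀ j, 0 ≤ X j ∧ X j ≠ 0)
    (hY : ∀ j, 0 ≤ Y j ∧ Y j ≠ 0) (hP : InputCond P) (hQ : OutputCond Q)
    (hv : ∃ v ∈ weightCone P, v ≠ 0) {x : Fin m → ℝ} {y : Fin s → ℝ}
    (hz : (x, y) ∈ dataSet X Y P Q) :
    IsLeast (inputValuesNat X Y P Q x y) (DMinusNat X Y P Q x y) ∧
    IsLeast (outputValuesNat X Y P Q x y) (DPlusNat X Y P Q x y) ∧
    IsGreatest (sbmValuesNat X Y P Q x y) (FSNat X Y P Q x y) ∧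
    IsGreatest (brwzValuesNat X Y P Q x y) (FBNat X Y P Q x y) := by
  obtain ⟨hA, hB, hS, hBr⟩ := measures_of_mem_dataSet hX hY hP hQ hv hz
  refine ⟨isLeast_inputValuesNat hX hY hP hQ hv hz hA hB,
    isLeast_outputValuesNat hX hY hP hQ hv hz hA hB, ?_, ?_⟩
  · rw [hS]; exact isGreatest_sbmValuesNat hX hY hP hQ hv hz hA hB
  · rw [hBr]; exact isGreatest_brwzValuesNat hX hY hP hQ hv hz hA hB

theorem continuousOn_measures [Nonempty (Fin n)] [Nonempty (Fin m)]
    (hX : ∀ j, 0 ≤ X j ∧ X j ≠ 0)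
    (hY : ∀ j, 0 ≤ Y j ∧ Y j ≠ 0) (hP : InputCond P) (hQ : OutputCond Q)
    (hv : ∃ v ∈ weightCone P, v ≠ 0) :
    ContinuousOn (fun z => DMinusNat X Y P Q z.1 z.2) (dataSet X Y P Q) ∧
    ContinuousOn (fun z => DPlusNat X Y P Q z.1 z.2) (dataSet X Y P Q) ∧
    ContinuousOn (fun z => FSNat X Y P Q z.1 z.2) (dataSet X Y P Q) ∧
    ContinuousOn (fun z => FBNat X Y P Q z.1 z.2) (dataSet X Y P Q) := by
  have H := fun z (hz : z ∈ dataSet X Y P Q) => measures_of_mem_dataSet hX hY hP hQ hv hz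
  have h1 : ContinuousOn (fun z => DMinusNat X Y P Q z.1 z.2) (dataSet X Y P Q) :=
    (inputAxisFamily hX hY hP hQ hv).continuousOn_dist fun z hz => (H z hz).1
  have h2 : ContinuousOn (fun z => DPlusNat X Y P Q z.1 z.2) (dataSet X Y P Q) :=
    (outputAxisFamily hX hY hP hQ hv).continuousOn_dist fun z hz => (H z hz).2.1
  have hpos : ∀ z ∈ dataSet X Y P Q, 0 ≤ DPlusNat X Y P Q z.1 z.2 := fun z hz => (H z hz).2.1.1
  have hm : ContinuousOn (fun z => 1 - DMinusNat X Y P Q z.1 z.2 / m) (dataSet X Y P Q) :=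
    continuousOn_const.sub (h1.div_const _)
  refine ⟨h1, h2, ContinuousOn.congr (hm.sup (continuousOn_const.div
    (continuousOn_const.add h2) fun z hz => ?_)) fun z hz => (H z hz).2.2.1,
    ContinuousOn.congr (hm.sup (continuousOn_const.sub ((h2.div
    (continuousOn_const.add h2) fun z hz => ?_).div_const _))) fun z hz => (H z hz).2.2.2⟩
  · have h3 := one_le_cast_of_ne_zero hz.2.2.2.1
    have h4 := hpos z hz
    exact (by linarith : 0 < (s : ℝ) + DPlusNat X Y P Q z.1 z.2).ne'
  · have h4 := hpos z hz
    exact (by linarith : 0 < 1 + DPlusNat X Y P Q z.1 z.2).ne'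

end Continuity

end DEA

end

open DEA in
theorem theorem11 {n m s p q : ℕ}
    (X : Fin n → Fin m → ℝ) (Y : Fin n → Fin s → ℝ)
    (P : Matrix (Fin m) (Fin p) ℝ) (Q : Matrix (Fin s) (Fin q) ℝ)
    (hX : ∀ j, 0 ≤ X j ∧ X j ≠ 0) (hY : ∀ j, 0 ≤ Y j ∧ Y j ≠ 0)
    (hP : InputCond P) (hQ : OutputCond Q)
    (x : Fin m → ℝ) (y : Fin s → ℝ)
    (hx : 0 ≤ x) (hx0 : x ≠ 0) (hy : 0 ≤ y) (hy0 : y ≠ 0)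
    (hT : (x, y) ∈ pps X Y P Q) :
    -- the four limits
    (Tendsto (fun ε : (Fin m → ℝ) × (Fin s → ℝ) => DMinus X Y P Q (x + ε.1) (y + ε.2))
        (𝓝[admissible X Y P Q x y] 0) (𝓝 (DMinusNat X Y P Q x y)) ∧
      Tendsto (fun ε : (Fin m → ℝ) × (Fin s → ℝ) => DPlus X Y P Q (x + ε.1) (y + ε.2))
        (𝓝[admissible X Y P Q x y] 0) (𝓝 (DPlusNat X Y P Q x y)) ∧
      Tendsto (fun ε : (Fin m → ℝ) × (Fin s → ℝ) => FS X Y P Q (x + ε.1) (y + ε.2))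
        (𝓝[admissible X Y P Q x y] 0) (𝓝 (FSNat X Y P Q x y)) ∧
      Tendsto (fun ε : (Fin m → ℝ) × (Fin s → ℝ) => FB X Y P Q (x + ε.1) (y + ε.2))
        (𝓝[admissible X Y P Q x y] 0) (𝓝 (FBNat X Y P Q x y))) ∧
    -- the limits are taken at an accumulation point
    (((∃ i, x i = 0) ∨ (∀ r, 0 < y r) ∨ (x, y) ∉ strongFrontier X Y P Q) →
      (𝓝[admissible X Y P Q x y] (0 : (Fin m → ℝ) × (Fin s → ℝ))).NeBot) ∧
    -- all minima and maxima are attained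
    ((∃ v ∈ weightCone P, v ≠ 0) →
      (IsLeast (inputValuesNat X Y P Q x y) (DMinusNat X Y P Q x y) ∧
        IsLeast (outputValuesNat X Y P Q x y) (DPlusNat X Y P Q x y) ∧
        IsGreatest (sbmValuesNat X Y P Q x y) (FSNat X Y P Q x y) ∧
        IsGreatest (brwzValuesNat X Y P Q x y) (FBNat X Y P Q x y)) ∧
      ∀ ε ∈ admissible X Y P Q x y,
        IsLeast (inputValues X Y P Q (x + ε.1) (y + ε.2))
          (DMinus X Y P Q (x + ε.1) (y + ε.2)) ∧
        IsLeast (outputValues X Y P Q (x + ε.1) (y + ε.2))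
          (DPlus X Y P Q (x + ε.1) (y + ε.2)) ∧
        IsGreatest (sbmValues X Y P Q (x + ε.1) (y + ε.2))
          (FS X Y P Q (x + ε.1) (y + ε.2)) ∧
        IsGreatest (brwzValues X Y P Q (x + ε.1) (y + ε.2))
          (FB X Y P Q (x + ε.1) (y + ε.2))) := by
  have : Nonempty (Fin n) := nonempty_units hQ hy hy0 hT
  have : Nonempty (Fin m) := by
    obtain ⟨i, -⟩ := Function.ne_iff.1 hx0
    exact ⟨i⟩
  -- At perturbed points the measures for positive data are those for data with zeros.
  have e1 : ∀ ε ∈ admissible X Y P Q x y, inputValues X Y P Q (x + ε.1) (y + ε.2) =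
      inputValuesNat X Y P Q (x + ε.1) (y + ε.2) := fun ε hε =>
    inputValues_eq (perturbed_positive hx hy hε).1
  have e2 : ∀ ε ∈ admissible X Y P Q x y, outputValues X Y P Q (x + ε.1) (y + ε.2) =
      outputValuesNat X Y P Q (x + ε.1) (y + ε.2) := fun ε hε =>
    outputValues_eq (perturbed_positive hx hy hε).2
  have e3 : ∀ ε ∈ admissible X Y P Q x y, sbmValues X Y P Q (x + ε.1) (y + ε.2) =
      sbmValuesNat X Y P Q (x + ε.1) (y + ε.2) := fun ε hε =>
    sbmValues_eq (perturbed_positive hx hy hε).1 (perturbed_positive hx hy hε).2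
  have e4 : ∀ ε ∈ admissible X Y P Q x y, brwzValues X Y P Q (x + ε.1) (y + ε.2) =
      brwzValuesNat X Y P Q (x + ε.1) (y + ε.2) := fun ε hε =>
    brwzValues_eq (perturbed_positive hx hy hε).1 (perturbed_positive hx hy hε).2
      (perturbed_mem_dataSet hx hx0 hy hy0 hε).2.2.2.1
  have hz : (x, y) ∈ dataSet X Y P Q := ⟨hx, hx0, hy, hy0, hT⟩
  refine ⟨?_, neBot_admissible hX hY hP hQ hx0 hy hy0 hT, fun hv =>
    ⟨measures_attained hX hY hP hQ hv hz, fun ε hε => ?_⟩⟩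
  · by_cases hv : ∃ v ∈ weightCone P, v ≠ 0
    · have ht := tendsto_perturbed (X := X) (Y := Y) (P := P) (Q := Q) hx hx0 hy hy0
      obtain ⟨c1, c2, c3, c4⟩ := continuousOn_measures hX hY hP hQ hv
      refine ⟨((c1 _ hz).tendsto.comp ht).congr' ?_, ((c2 _ hz).tendsto.comp ht).congr' ?_,
        ((c3 _ hz).tendsto.comp ht).congr' ?_, ((c4 _ hz).tendsto.comp ht).congr' ?_⟩ <;>
        filter_upwards [self_mem_nhdsWithin] with ε hε
      · exact congrArg sInf (e1 ε hε).symm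
      · exact congrArg sInf (e2 ε hε).symm
      · exact congrArg sSup (e3 ε hε).symm
      · exact congrArg sSup (e4 ε hε).symm
    · -- The frontier is empty, and all eight measures are zero by the conventions for `∅`.
      have he := strongFrontier_eq_empty (X := X) hY hQ hv
      simp [DMinus, DPlus, FS, FB, DMinusNat, DPlusNat, FSNat, FBNat, inputValues, outputValues,
        sbmValues, brwzValues, inputValuesNat, outputValuesNat, sbmValuesNat, brwzValuesNat, he,
        tendsto_const_nhds]
  · simp only [DMinus, DPlus, FS, FB, e1 ε hε, e2 ε hε, e3 ε hε, e4 ε hε]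
    exact measures_attained hX hY hP hQ hv (perturbed_mem_dataSet hx hx0 hy hy0 hε)
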